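/- **Setting.** Fix $d$ and $N\ge 2$, and a finite dimensional single-site Hilbert space $\mathcal H_0$; to each $x\in\mathbb Z^d$ attach a copy $\mathcal H_x$ of $\mathcal H_0$. * *Symmetry.* Let $R\mapsto\widehat R$ be a unitary representation of $SO(N)$ on $\mathcal H_0$, possibly only up to phase factors (so that half-integer spins are included), for which $R\mapsto \widehat R M\widehat R^{-1}$ is continuous for every operator $M$. Let $\widehat R_x$ be the copy of $\widehat R$ acting on $\mathcal H_x$, and $\widehat R_A=\bigotimes_{x\in A}\widehat R_x$. * *Interaction.* For every finite $A\subset\mathbb Z^d$ let $Q_A$ be a self-adjoint operator on $\bigotimes_{x\in A}\mathcal H_x$, such that the family is translation invariant and $\widehat R_A^{-1}Q_A\widehat R_A=Q_A$ for all $R\in SO(N)$. * *Field operators.* Let $\vec\kappa_0=(\kappa_{0,1},\dots,\kappa_{0,N})$ be self-adjoint operators on a finite set of sites $S$ (for example $S=\{0\}$) that transform as a vector, $\widehat R_S(\vec v\cdot\vec\kappa_0)\widehat R_S^{-1}=(R\vec v)\cdot\vec\kappa_0$ for all $R\in SO(N)$ and $\vec v\in\mathbb R^N$, and let $\vec\kappa_x$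 be their translates by $x$. * *Disorder.* Let $(\vec\eta_x)_{x\in\mathbb Z^d}$ be i.i.d. random vectors in $\mathbb R^N$ of finite variance, with a distribution invariant under $SO(N)$. * *Free energy.* Let $\Gamma_K=[-K,K]^d\cap\mathbb Z^d$, let $\epsilon\in\mathbb R$, and let $$H_K^{\vec h}(\vec\eta)=\sum_A P_K(Q_A)+\sum_{x\in\Gamma_K}(\vec h+\epsilon\vec\eta_x)\cdot P_K(\vec\kappa_x)$$ be the Hamiltonian with periodic boundary conditions. Here $P_K$ maps each site to the site of $\Gamma_K$ congruent to it modulo $2K+1$. The first sum is over finite nonempty $A$, one from each class modulo translations by $(2K+1)\mathbb Z^d$, that do not contain two congruent sites. For $0<\beta<\infty$ let $F_K^{\vec h}(\vec\eta)=-\beta^{-1}\log\operatorname{Tr}e^{-\beta H_K^{\vec h}(\vec\eta)}$; for $\beta=\infty$ let $F_K^{\vec h}(\vec\eta)$ be the lowest eigenvalue of $H_K^{\vec h}(\vec\eta)$. * *Free energy difference.* Let $\hat e\in\mathbb R^N$ be a unit vector and let $r_L\vec\eta$ be $\vec\eta$ with $\vec\eta_x$ replaced by $0$ for all $x\in\Gamma_L$.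 For $\delta\in\mathbb R$ put $$\mathcal G_{L,K}^{\delta\hat e}=\tfrac12\,\mathbb E\Big[F_K^{\delta\hat e}(\vec\eta)-F_K^{\delta\hat e}(r_L\vec\eta)-F_K^{-\delta\hat e}(\vec\eta)+F_K^{-\delta\hat e}(r_L\vec\eta)\,\Big|\,(\hat e\cdot\vec\eta_x)_{x\in\Gamma_L}\Big].$$ For sequences $\delta_i\to0$ and $K_j\to\infty$ put $$G_L=\lim_{i\to\infty}\lim_{j\to\infty}\big(\mathcal G_{L,K_j}^{\delta_i\hat e}-\mathbb E\,\mathcal G_{L,K_j}^{\delta_i\hat e}\big)$$ whenever these limits exist for almost every $\vec\eta$. **Lemma.** Suppose that the interaction is of finite range (there is $r$ with $Q_A=0$ whenever $\operatorname{diam}A>r$), or that $$\sum_{A\ni0}(\operatorname{diam}A)^2\,|A|\,\|Q_A\|<\infty .$$ Then there is a constant $C<\infty$, depending only on the interaction, the symmetry, $\vec\kappa_0$, $\epsilon$ and the distribution of the disorder, such that for every $\beta\in(0,\infty]$, every unit vector $\hat e$, every integer $L\ge1$ and all sequences $\delta_i\to0$, $K_j\to\infty$ for which the limit $G_L$ exists,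 $$|G_L|\le C\,L^{d-2}\qquad\text{for almost every }\vec\eta .$$ -/

import Mathlib

open MeasureTheory ProbabilityTheory Filter Topology Matrix

noncomputable section

namespace QuantumImryMa

/-- The sites of the lattice `ℤ^d`. -/
abbrev Site (d : ℕ) : Type := Fin d → ℤ

/-- The space `ℝ^N` of the field vectors, with its Euclidean norm. -/
abbrev Vec (N : ℕ) : Type := EuclideanSpace ℝ (Fin N)

/-- Operators on `⊗_{x ∈ X} ℂ^ι`, written in the product basis, which is indexed by `X → ι`. -/
abbrev Op (X ι : Type*) : Type _ := Matrix (X → ι) (X → ι) ℂ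

/-- The cube `[-L, L]^d ∩ ℤ^d`. -/
def box (d L : ℕ) : Finset (Site d) :=
  Fintype.piFinset fun _ => Finset.Icc (-(L : ℤ)) (L : ℤ)

/-- The translate `A + x`. -/
def translate {d : ℕ} (x : Site d) (A : Finset (Site d)) : Finset (Site d) :=
  A.map (addRightEmbedding x)

lemma add_mem_translate {d : ℕ} (x : Site d) {A : Finset (Site d)} (a : A) :
    (a : Site d) + x ∈ translate x A :=
  Finset.mem_map_of_mem (addRightEmbedding x) a.2

/-- The operator norm for the Euclidean norm. -/
def opNorm {X : Type*} [Fintype X] [DecidableEq X] (M : Matrix X X ℂ) : ℝ :=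
  ‖Matrix.toEuclideanCLM (n := X) (𝕜 := ℂ) M‖

/-- The tensor power `⊗_{x ∈ X} U` of a single-site operator. -/
def tensorPower (X : Type*) [Fintype X] {ι : Type*} (U : Matrix ι ι ℂ) : Op X ι :=
  fun σ τ => ∏ x, U (σ x) (τ x)

open Classical in
/-- The operator `M ⊗ 1` on the sites `Y`, where the operator `M` on the sites `X` is carried to the
sites `f(X)` by an injective `f`. It is set to `0` if `f` is not injective. -/
def embed {X Y ι : Type*} (f : X → Y) (M : Op X ι) : Op Y ι :=
  fun σ τ =>
    if Function.Injective f ∧ ∀ y, y ∉ Set.range f → σ y = τ y then M (σ ∘ f) (τ ∘ f) else 0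

/-- A rotation acting on a vector. -/
def rotate {N : ℕ} (R : Matrix.specialOrthogonalGroup (Fin N) ℝ) (v : Vec N) : Vec N :=
  WithLp.toLp 2 ((R : Matrix (Fin N) (Fin N) ℝ) *ᵥ v.ofLp)

/-- A translation invariant quantum lattice system on `ℤ^d` with single-site space `ℂ^ι` and a
rotation symmetry `SO(N)`.

The rotations act on the single-site space by unitary operators which multiply up to phases only, so
that half-integer spins are included; the action by conjugation is continuous. The field is coupled
to the vector operator `lop x = (lop x 1, …, lop x N)`, the translate by `x` of operators `lop`
acting on the finite set of sites `cluster`. -/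
structure SymmetricSystem (d N : ℕ) (ι : Type*) [Fintype ι] [DecidableEq ι] where
  /-- the interaction `Q_A` -/
  Q : (A : Finset (Site d)) → Op A ι
  Q_hermitian : ∀ A, (Q A).IsHermitian
  Q_translate : ∀ (x : Site d) (A : Finset (Site d)) (σ τ : translate x A → ι),
    Q (translate x A) σ τ =
      Q A (fun a => σ ⟨a + x, add_mem_translate x a⟩) (fun a => τ ⟨a + x, add_mem_translate x a⟩)
  /-- the single-site unitary operators of the rotations -/
  rep : Matrix.specialOrthogonalGroup (Fin N) ℝ → Matrix.unitaryGroup ι ℂ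
  rep_mul : ∀ R S, ∃ c : ℂ, ‖c‖ = 1 ∧
    (rep (R * S) : Matrix ι ι ℂ) = c • ((rep R : Matrix ι ι ℂ) * (rep S : Matrix ι ι ℂ))
  rep_continuous : ∀ M : Matrix ι ι ℂ,
    Continuous fun R => (rep R : Matrix ι ι ℂ) * M * (rep R : Matrix ι ι ℂ)ᴴ
  Q_rotate : ∀ R (A : Finset (Site d)), (tensorPower A (rep R : Matrix ι ι ℂ))ᴴ * Q A *
    tensorPower A (rep R : Matrix ι ι ℂ) = Q A
  /-- the sites on which the vector operator attached to the origin acts -/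
  cluster : Finset (Site d)
  /-- the components of the vector operator attached to the origin -/
  lop : Fin N → Op cluster ι
  lop_hermitian : ∀ k, (lop k).IsHermitian
  lop_rotate : ∀ R (v : Vec N),
    tensorPower cluster (rep R : Matrix ι ι ℂ) * (∑ k, (v k : ℂ) • lop k) *
      (tensorPower cluster (rep R : Matrix ι ι ℂ))ᴴ = ∑ k, (rotate R v k : ℂ) • lop k

namespace SymmetricSystem

variable {d N : ℕ} {ι : Type*} [Fintype ι] [DecidableEq ι]

/-- `Q_A = 0` for all sets of large diameter. -/
def FiniteRange (S : SymmetricSystem d N ι) : Prop :=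
  ∃ r : ℝ, ∀ A : Finset (Site d), r < Metric.diam (A : Set (Site d)) → S.Q A = 0

/-- `∑_{A ∋ 0} (diam A)² |A| ‖Q_A‖ < ∞`. -/
def ShortRange (S : SymmetricSystem d N ι) : Prop :=
  Summable fun A : {A : Finset (Site d) // (0 : Site d) ∈ A} =>
    Metric.diam (A.1 : Set (Site d)) ^ 2 * (A.1.card : ℝ) * opNorm (S.Q A.1)

/-- The sites of the cube `[-K, K]^d` with periodic boundary conditions. -/
abbrev Torus (d K : ℕ) : Type := Fin d → ZMod (2 * K + 1)

/-- The map from the lattice to the periodic cube. -/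
def toTorus (d K : ℕ) (x : Site d) : Torus d K := fun i => (x i : ZMod (2 * K + 1))

/-- The interaction part of the periodic Hamiltonian: every finite nonempty `A`, up to translations
by multiples of the period, contributes once, with its sites mapped into the periodic cube. (For
such an `A` there are `|A|` pairs `x ∈ A'` with `x` in the cube and `A'` a translate of `A` by a
period, hence the weights.) A set two points of which are mapped to the same site does not
contribute. -/
def interaction (S : SymmetricSystem d N ι) (K : ℕ) : Op (Torus d K) ι :=
  ∑ x ∈ box d K, ∑' A : {A : Finset (Site d) // x ∈ A},
    ((A.1.card : ℂ))⁻¹ • embed (fun a : A.1 => toTorus d K a) (S.Q A.1)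

/-- The vector operator attached to `x`, in the periodic cube. -/
def lopAt (S : SymmetricSystem d N ι) (K : ℕ) (x : Site d) (k : Fin N) : Op (Torus d K) ι :=
  embed (fun a : S.cluster => toTorus d K (a + x)) (S.lop k)

/-- The Hamiltonian on `[-K, K]^d` with periodic boundary conditions, uniform field `h` and random
fields `η`, at disorder strength `ε`. -/
def hamiltonian (S : SymmetricSystem d N ι) (ε : ℝ) (K : ℕ) (h : Vec N) (η : Site d → Vec N) :
    Op (Torus d K) ι :=
  S.interaction K + ∑ x ∈ box d K, ∑ k, (((h + ε • η x) k : ℝ) : ℂ) • S.lopAt K x k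

end SymmetricSystem

/-- The free energy `-β⁻¹ log Tr e^{-βH}` for `0 < β < ∞`, and the ground state energy, that is
the lowest eigenvalue of `H`, for `β = ∞`. -/
def freeEnergy {X : Type*} [Fintype X] [DecidableEq X] (β : ENNReal) (H : Matrix X X ℂ) : ℝ :=
  if β = ⊤ then sInf (spectrum ℝ H)
  else -(1 / β.toReal) * Real.log (Matrix.trace (NormedSpace.exp (-(β.toReal : ℂ) • H))).re

/-- The field with the values in `[-L, L]^d` replaced by `0`. -/
def resetField {d N : ℕ} (L : ℕ) (η : Site d → Vec N) : Site d → Vec N :=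
  fun x => if x ∈ box d L then 0 else η x

/-- Independent, identically distributed random vectors in `ℝ^N` of finite variance, with a
rotation invariant distribution. -/
structure IsotropicDisorder {d N : ℕ} {Ω : Type*} [MeasurableSpace Ω] (P : Measure Ω)
    (η : Site d → Ω → Vec N) : Prop where
  measurable : ∀ x, Measurable (η x)
  indep : iIndepFun η P
  ident : ∀ x y, IdentDistrib (η x) (η y) P P
  rotation_invariant : ∀ (R : Matrix.specialOrthogonalGroup (Fin N) ℝ) (x : Site d),
    P.map (fun ω => rotate R (η x ω)) = P.map (η x)
  finite_variance : ∀ x, MemLp (η x) 2 P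

namespace SymmetricSystem

variable {d N : ℕ} {ι : Type*} [Fintype ι] [DecidableEq ι]

/-- `F_K^h(η)`, the free energy on `[-K, K]^d` with periodic boundary conditions. -/
def F (S : SymmetricSystem d N ι) (β : ENNReal) (ε : ℝ) (K : ℕ) (h : Vec N)
    (η : Site d → Vec N) : ℝ :=
  freeEnergy β (S.hamiltonian ε K h η)

/-- The finite volume free energy difference: half the conditional expectation of
`F_K^{δe}(η) - F_K^{δe}(r_L η) - F_K^{-δe}(η) + F_K^{-δe}(r_L η)`, given the components
`e · η_x` of the fields at the sites `x` of `[-L, L]^d`. -/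
def freeEnergyDifference (S : SymmetricSystem d N ι) {Ω : Type*} [MeasurableSpace Ω]
    (P : Measure Ω) (η : Site d → Ω → Vec N) (β : ENNReal) (ε : ℝ) (e : Vec N)
    (L K : ℕ) (δ : ℝ) : Ω → ℝ :=
  (1 / 2 : ℝ) •
    P[fun ω => S.F β ε K (δ • e) (fun x => η x ω)
        - S.F β ε K (δ • e) (resetField L fun x => η x ω)
        - S.F β ε K (-(δ • e)) (fun x => η x ω)
        + S.F β ε K (-(δ • e)) (resetField L fun x => η x ω)
      | MeasurableSpace.comap (fun ω (x : box d L) => (inner ℝ e (η x ω) : ℝ)) inferInstance]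

/-- `G` is the limit, first `j → ∞` and then `i → ∞`, of the centred finite volume free energy
differences in the cubes `[-K_j, K_j]^d` with the fields `±δ_i e`, for almost all values of the
disorder. -/
def IsLimitFreeEnergyDifference (S : SymmetricSystem d N ι) {Ω : Type*} [MeasurableSpace Ω]
    (P : Measure Ω) (η : Site d → Ω → Vec N) (β : ENNReal) (ε : ℝ) (e : Vec N)
    (δ : ℕ → ℝ) (K : ℕ → ℕ) (L : ℕ) (G : Ω → ℝ) : Prop :=
  ∃ g : ℕ → Ω → ℝ, ∀ᵐ ω ∂P,
    (∀ i, Tendsto (fun j => S.freeEnergyDifference P η β ε e L (K j) (δ i) ω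
        - ∫ ω', S.freeEnergyDifference P η β ε e L (K j) (δ i) ω' ∂P) atTop (𝓝 (g i ω))) ∧
    Tendsto (fun i => g i ω) atTop (𝓝 (G ω))

end SymmetricSystem

end QuantumImryMa

end

/-!
Rotate the spins at the sites `x` by an angle that vanishes on `[-L, L]^d`, grows to `π` across the
shell of thickness `L` around it, and equals `π` further out. The rotations carry the uniform field
`h = δe` to `-h` far away, and they rotate the random fields. A rotation of the random fields off
`[-L, L]^d` changes neither their law nor the components on which one conditions, so it is invisible
in the conditional expectation.

To first order in the gradient `L⁻¹` of the angle the rotation costs an energy of order `L^d * L⁻¹`.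
This term cancels when the rotations by `θ` and `-θ` are averaged: the free energy is concave and
invariant under unitary conjugation, so the average of the two free energies is at most the free
energy of the average of the two conjugated Hamiltonians, and each local term of the latter differs
from the original one only by a second difference, of order `L⁻²`. There are of order `L^d` such
terms. The uniform field, which fails to be reversed at of order `L^d` sites, costs a multiple of
`L^d * |δ|`, which disappears as `δ → 0`. Exchanging `δ` and `-δ` bounds the difference of the
conditional expectations from both sides.
-/

noncomputable section

namespace QuantumImryMa

section FreeEnergy

open scoped Matrix.Norms.L2Operator

variable {X : Type*} [Fintype X]

lemma convexOn_log_sum_exp [Nonempty X] :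
    ConvexOn ℝ Set.univ fun x : X → ℝ => Real.log (∑ i, Real.exp (x i)) := by
  have sum_pos : ∀ x : X → ℝ, 0 < ∑ i, Real.exp (x i) := fun x =>
    Finset.sum_pos (fun i _ => Real.exp_pos _) Finset.univ_nonempty
  have sum_normalized : ∀ x : X → ℝ, ∑ i, Real.exp (x i - Real.log (∑ j, Real.exp (x j))) = 1 := by
    intro x
    simp_rw [Real.exp_sub, Real.exp_log (sum_pos x), ← Finset.sum_div, div_self (sum_pos x).ne']
  refine ⟨convex_univ, fun x _ y _ a b ha hb hab => ?_⟩
  -- After subtracting the two logarithms, both sums of exponentials are `1`.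
  have normalized_le :
      ∑ i, Real.exp (a * (x i - Real.log (∑ j, Real.exp (x j))) +
        b * (y i - Real.log (∑ j, Real.exp (y j)))) ≤ 1 := by
    calc _ ≤ ∑ i, (a * Real.exp (x i - Real.log (∑ j, Real.exp (x j))) +
          b * Real.exp (y i - Real.log (∑ j, Real.exp (y j)))) :=
        Finset.sum_le_sum fun i _ =>
          convexOn_exp.2 (Set.mem_univ _) (Set.mem_univ _) ha hb hab
      _ = 1 := by
        rw [Finset.sum_add_distrib, ← Finset.mul_sum, ← Finset.mul_sum, sum_normalized,
          sum_normalized, mul_one, mul_one, hab]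
  simp only [Pi.add_apply, Pi.smul_apply, smul_eq_mul]
  rw [Real.log_le_iff_le_exp (sum_pos _), ← div_le_one (Real.exp_pos _), Finset.sum_div]
  refine le_of_eq_of_le (Finset.sum_congr rfl fun i _ => ?_) normalized_le
  rw [← Real.exp_sub]
  congr 1
  ring

/-- The free energy at inverse temperature `β` of a system with the energy levels `E i`, and the
lowest level for `β = ∞`. It is the free energy of a diagonal Hamiltonian. -/
def classicalFreeEnergy (β : ENNReal) (E : X → ℝ) : ℝ :=
  if β = ⊤ then ⨅ i, E i
  else -(1 / β.toReal) * Real.log (∑ i, Real.exp (-β.toReal * E i))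

lemma classicalFreeEnergy_mono [Nonempty X] (β : ENNReal) :
    Monotone (classicalFreeEnergy β : (X → ℝ) → ℝ) := by
  intro E E' hE
  unfold classicalFreeEnergy
  split_ifs
  · exact ciInf_mono (Set.finite_range E).bddBelow hE
  · refine mul_le_mul_of_nonpos_left ?_ (neg_nonpos.2 (by positivity))
    refine Real.log_le_log
      (Finset.sum_pos (fun i _ => Real.exp_pos _) Finset.univ_nonempty) ?_
    refine Finset.sum_le_sum fun i _ => Real.exp_le_exp.2 ?_
    exact mul_le_mul_of_nonpos_left (hE i) (neg_nonpos.2 ENNReal.toReal_nonneg)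

lemma classicalFreeEnergy_add_const [Nonempty X] {β : ENNReal} (hβ : β ≠ 0) (E : X → ℝ) (c : ℝ) :
    (classicalFreeEnergy β fun i => E i + c) = classicalFreeEnergy β E + c := by
  unfold classicalFreeEnergy
  split_ifs with hβ'
  · exact (ciInf_add (Set.finite_range E).bddBelow c).symm
  · have hb : β.toReal ≠ 0 := (ENNReal.toReal_pos hβ hβ').ne'
    have sum_pos : 0 < ∑ i, Real.exp (-β.toReal * E i) :=
      Finset.sum_pos (fun i _ => Real.exp_pos _) Finset.univ_nonempty
    simp_rw [mul_add, Real.exp_add, ← Finset.sum_mul]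
    rw [Real.log_mul sum_pos.ne' (Real.exp_pos _).ne', Real.log_exp]
    field_simp
    ring

lemma classicalFreeEnergy_comp_perm (β : ENNReal) (E : X → ℝ) (σ : Equiv.Perm X) :
    classicalFreeEnergy β (E ∘ σ) = classicalFreeEnergy β E := by
  simp only [classicalFreeEnergy, Function.comp_apply]
  rw [σ.iInf_congr (g := E) fun _ => rfl, Equiv.sum_comp σ fun i => Real.exp (-β.toReal * E i)]

lemma concaveOn_classicalFreeEnergy [Nonempty X] (β : ENNReal) :
    ConcaveOn ℝ Set.univ (classicalFreeEnergy β : (X → ℝ) → ℝ) := by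
  unfold classicalFreeEnergy
  split_ifs
  · refine ⟨convex_univ, fun E _ E' _ a b ha hb _ => le_ciInf fun i => ?_⟩
    exact add_le_add
      (mul_le_mul_of_nonneg_left (ciInf_le (Set.finite_range E).bddBelow i) ha)
      (mul_le_mul_of_nonneg_left (ciInf_le (Set.finite_range E').bddBelow i) hb)
  · have convex_log := (convexOn_log_sum_exp (X := X)).comp_linearMap
      (-β.toReal • LinearMap.id : (X → ℝ) →ₗ[ℝ] X → ℝ)
    refine (convex_log.smul (c := 1 / β.toReal) (by positivity)).neg.congr fun E _ => ?_
    simp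

variable [DecidableEq X]

/-- By Birkhoff's theorem this is concavity together with invariance under permutations. -/
lemma classicalFreeEnergy_le_doublyStochastic_mulVec [Nonempty X] (β : ENNReal) {M : Matrix X X ℝ}
    (hM : M ∈ doublyStochastic ℝ X) (E : X → ℝ) :
    classicalFreeEnergy β E ≤ classicalFreeEnergy β (M *ᵥ E) := by
  obtain ⟨w, hw_nonneg, hw_sum, rfl⟩ := exists_eq_sum_perm_of_mem_doublyStochastic hM
  calc classicalFreeEnergy β E
      = ∑ σ, w σ • classicalFreeEnergy β (E ∘ σ) := by
        simp_rw [classicalFreeEnergy_comp_perm, ← Finset.sum_smul, hw_sum, one_smul]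
    _ ≤ classicalFreeEnergy β (∑ σ, w σ • (E ∘ σ)) :=
        (concaveOn_classicalFreeEnergy β).le_map_sum (fun σ _ => hw_nonneg σ) hw_sum
          fun _ _ => Set.mem_univ _
    _ = _ := by simp_rw [Matrix.sum_mulVec, Matrix.smul_mulVec, Matrix.permMatrix_mulVec]

lemma norm_sq_mem_doublyStochastic {W : Matrix X X ℂ} (hW : W ∈ unitaryGroup X ℂ) :
    (of fun i j => ‖W i j‖ ^ 2 : Matrix X X ℝ) ∈ doublyStochastic ℝ X := by
  have sum_row : ∀ {W : Matrix X X ℂ}, W ∈ unitaryGroup X ℂ → ∀ i, ∑ j, ‖W i j‖ ^ 2 = 1 := by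
    intro W hW i
    have mul_star : W * star W = 1 := Unitary.mul_star_self_of_mem hW
    have hii := congrFun₂ mul_star i i
    simp only [Matrix.mul_apply, Matrix.star_apply, RCLike.star_def, Complex.mul_conj',
      Matrix.one_apply_eq] at hii
    exact_mod_cast hii
  rw [mem_doublyStochastic_iff_sum]
  refine ⟨fun _ _ => by simp only [of_apply]; positivity, sum_row hW, fun j => ?_⟩
  simpa only [of_apply, Matrix.star_apply, norm_star] using sum_row (Unitary.star_mem hW) j

/-- The diagonal entries of a matrix in the orthonormal basis given by the columns of `V`. -/
def diagIn (V : Matrix X X ℂ) : Matrix X X ℂ →ₗ[ℝ] X → ℝ where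
  toFun A i := ((Vᴴ * A * V) i i).re
  map_add' A B := by ext i; simp [Matrix.mul_add, Matrix.add_mul]
  map_smul' c A := by ext i; simp

lemma diagIn_apply (V A : Matrix X X ℂ) (i : X) : diagIn V A i = ((Vᴴ * A * V) i i).re := rfl

omit [Fintype X] [DecidableEq X] in
lemma norm_entry_le {m n : Type*} [Fintype m] [Fintype n] [DecidableEq n] (M : Matrix m n ℂ)
    (i : m) (j : n) : ‖M i j‖ ≤ ‖M‖ := by
  let e : EuclideanSpace ℂ n := EuclideanSpace.single j 1
  let column : EuclideanSpace ℂ m := (EuclideanSpace.equiv m ℂ).symm (M *ᵥ e.ofLp)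
  calc ‖M i j‖ = ‖column i‖ := by simp [column, e]
    _ ≤ ‖column‖ := PiLp.norm_apply_le _ i
    _ ≤ ‖M‖ * ‖e‖ := l2_opNorm_mulVec M e
    _ = ‖M‖ := by rw [PiLp.norm_single, norm_one, mul_one]

lemma diagIn_le_norm {V : Matrix X X ℂ} (hV : V ∈ unitaryGroup X ℂ) (A : Matrix X X ℂ) (i : X) :
    diagIn V A i ≤ ‖A‖ := by
  calc diagIn V A i ≤ ‖(Vᴴ * A * V) i i‖ := Complex.re_le_norm _
    _ ≤ ‖Vᴴ * A * V‖ := norm_entry_le _ i i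
    _ = ‖A‖ := by
      rw [CStarRing.norm_mul_mem_unitary _ hV, ← star_eq_conjTranspose,
        CStarRing.norm_mem_unitary_mul _ (Unitary.star_mem hV)]

lemma diagIn_conj_diagonal (V U : Matrix X X ℂ) (l : X → ℝ) :
    diagIn V (U * diagonal (fun j => (l j : ℂ)) * Uᴴ) =
      (of fun i j => ‖(Vᴴ * U) i j‖ ^ 2) *ᵥ l := by
  ext i
  have entry : Vᴴ * (U * diagonal (fun j => (l j : ℂ)) * Uᴴ) * V =
      Vᴴ * U * diagonal (fun j => (l j : ℂ)) * (Vᴴ * U)ᴴ := by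
    simp only [Matrix.conjTranspose_mul, Matrix.conjTranspose_conjTranspose, Matrix.mul_assoc]
  rw [diagIn_apply, entry, Matrix.mul_apply, Complex.re_sum]
  refine Finset.sum_congr rfl fun j _ => ?_
  rw [Matrix.mul_diagonal, Matrix.conjTranspose_apply, mul_right_comm, RCLike.star_def,
    Complex.mul_conj']
  norm_cast

lemma diagIn_conj_diagonal_self {U : Matrix X X ℂ} (hU : U ∈ unitaryGroup X ℂ) (l : X → ℝ) :
    diagIn U (U * diagonal (fun j => (l j : ℂ)) * Uᴴ) = l := by
  rw [diagIn_conj_diagonal, ← star_eq_conjTranspose, Unitary.star_mul_self_of_mem hU]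
  ext i
  simp [Matrix.mulVec, dotProduct, Matrix.one_apply, apply_ite, ite_pow]

lemma exists_eigenbasis {A : Matrix X X ℂ} (hA : A.IsHermitian) :
    ∃ U ∈ unitaryGroup X ℂ, ∃ l : X → ℝ, A = U * diagonal (fun j => (l j : ℂ)) * Uᴴ :=
  ⟨hA.eigenvectorUnitary, hA.eigenvectorUnitary.2, hA.eigenvalues, hA.spectral_theorem⟩

lemma freeEnergy_conj {U : Matrix X X ℂ} (hU : U ∈ unitaryGroup X ℂ) (β : ENNReal)
    (A : Matrix X X ℂ) : freeEnergy β (Uᴴ * A * U) = freeEnergy β A := by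
  have mul_star : U * Uᴴ = 1 := Unitary.mul_star_self_of_mem hU
  have inv_eq : U⁻¹ = Uᴴ := Matrix.inv_eq_right_inv mul_star
  let u : (Matrix X X ℂ)ˣ := Unitary.toUnits ⟨U, hU⟩
  unfold freeEnergy
  congr 1
  · rw [show Uᴴ * A * U = ↑u⁻¹ * A * ↑u from rfl, spectrum.units_conjugate']
  · have exp_arg : -(β.toReal : ℂ) • (Uᴴ * A * U) = U⁻¹ * (-(β.toReal : ℂ) • A) * U := by
      rw [inv_eq, Matrix.mul_smul, Matrix.smul_mul]
    rw [exp_arg, Matrix.exp_conj' U _ u.isUnit, inv_eq, Matrix.trace_mul_cycle, mul_star, one_mul]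

lemma freeEnergy_diagonal (β : ENNReal) (l : X → ℝ) :
    freeEnergy β (diagonal fun j => (l j : ℂ)) = classicalFreeEnergy β l := by
  unfold freeEnergy classicalFreeEnergy
  congr 1
  · have spectrum_eq : spectrum ℝ (diagonal fun j => (l j : ℂ)) = Set.range l := by
      rw [← spectrum.preimage_algebraMap ℂ, spectrum_diagonal]
      ext r
      simp
    rw [spectrum_eq, sInf_range]
  · rw [← Matrix.diagonal_smul, Matrix.exp_diagonal, Matrix.trace_diagonal, Complex.re_sum]
    congr 2
    refine Finset.sum_congr rfl fun j _ => ?_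
    rw [Pi.coe_exp, ← Complex.exp_eq_exp_ℂ, Pi.smul_apply, smul_eq_mul]
    exact_mod_cast Complex.exp_ofReal_re _

lemma freeEnergy_conj_diagonal {U : Matrix X X ℂ} (hU : U ∈ unitaryGroup X ℂ) (β : ENNReal)
    (l : X → ℝ) :
    freeEnergy β (U * diagonal (fun j => (l j : ℂ)) * Uᴴ) = classicalFreeEnergy β l := by
  rw [← freeEnergy_diagonal, ← freeEnergy_conj (Unitary.star_mem hU) β (diagonal _),
    star_eq_conjTranspose, conjTranspose_conjTranspose]

/-- Peierls' inequality. -/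
lemma freeEnergy_le_classicalFreeEnergy_diagIn [Nonempty X] (β : ENNReal) {A V : Matrix X X ℂ}
    (hA : A.IsHermitian) (hV : V ∈ unitaryGroup X ℂ) :
    freeEnergy β A ≤ classicalFreeEnergy β (diagIn V A) := by
  obtain ⟨U, hU, l, rfl⟩ := exists_eigenbasis hA
  rw [freeEnergy_conj_diagonal hU, diagIn_conj_diagonal]
  exact classicalFreeEnergy_le_doublyStochastic_mulVec β
    (norm_sq_mem_doublyStochastic (mul_mem (Unitary.star_mem hV) hU)) l

lemma exists_freeEnergy_eq_classicalFreeEnergy_diagIn (β : ENNReal) {A : Matrix X X ℂ}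
    (hA : A.IsHermitian) :
    ∃ V ∈ unitaryGroup X ℂ, freeEnergy β A = classicalFreeEnergy β (diagIn V A) := by
  obtain ⟨U, hU, l, rfl⟩ := exists_eigenbasis hA
  exact ⟨U, hU, by rw [freeEnergy_conj_diagonal hU, diagIn_conj_diagonal_self hU]⟩

lemma concaveOn_freeEnergy [Nonempty X] (β : ENNReal) :
    ConcaveOn ℝ {A : Matrix X X ℂ | A.IsHermitian} (freeEnergy β) := by
  have isHermitian_smul : ∀ (a : ℝ) {A : Matrix X X ℂ}, A.IsHermitian → (a • A).IsHermitian :=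
    fun a A hA => by rw [IsHermitian, conjTranspose_smul, hA.eq, star_trivial]
  refine ⟨fun A hA B hB a b _ _ _ => (isHermitian_smul a hA).add (isHermitian_smul b hB),
    fun A hA B hB a b ha hb hab => ?_⟩
  obtain ⟨V, hV, hVmix⟩ := exists_freeEnergy_eq_classicalFreeEnergy_diagIn β
    ((isHermitian_smul a hA).add (isHermitian_smul b hB))
  calc a • freeEnergy β A + b • freeEnergy β B
      ≤ a • classicalFreeEnergy β (diagIn V A) + b • classicalFreeEnergy β (diagIn V B) :=
        add_le_add
          (smul_le_smul_of_nonneg_left (freeEnergy_le_classicalFreeEnergy_diagIn β hA hV) ha)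
          (smul_le_smul_of_nonneg_left (freeEnergy_le_classicalFreeEnergy_diagIn β hB hV) hb)
    _ ≤ classicalFreeEnergy β (a • diagIn V A + b • diagIn V B) :=
        (concaveOn_classicalFreeEnergy β).2 (Set.mem_univ _) (Set.mem_univ _) ha hb hab
    _ = freeEnergy β (a • A + b • B) := by rw [hVmix, map_add, map_smul, map_smul]

lemma freeEnergy_le_add_norm_sub [Nonempty X] {β : ENNReal} (hβ : β ≠ 0) {A B : Matrix X X ℂ}
    (hA : A.IsHermitian) (hB : B.IsHermitian) :
    freeEnergy β A ≤ freeEnergy β B + ‖A - B‖ := by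
  obtain ⟨V, hV, hVB⟩ := exists_freeEnergy_eq_classicalFreeEnergy_diagIn β hB
  rw [hVB, ← classicalFreeEnergy_add_const hβ]
  refine (freeEnergy_le_classicalFreeEnergy_diagIn β hA hV).trans
    (classicalFreeEnergy_mono β fun i => ?_)
  have diag_sub := diagIn_le_norm hV (A - B) i
  rw [map_sub, Pi.sub_apply] at diag_sub
  linarith

lemma abs_freeEnergy_sub_le [Nonempty X] {β : ENNReal} (hβ : β ≠ 0) {A B : Matrix X X ℂ}
    (hA : A.IsHermitian) (hB : B.IsHermitian) :
    |freeEnergy β A - freeEnergy β B| ≤ ‖A - B‖ := by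
  have hAB := freeEnergy_le_add_norm_sub hβ hA hB
  have hBA := freeEnergy_le_add_norm_sub hβ hB hA
  rw [norm_sub_rev] at hBA
  exact abs_sub_le_iff.2 ⟨by linarith, by linarith⟩

lemma freeEnergy_add_freeEnergy_le [Nonempty X] {β : ENNReal} (hβ : β ≠ 0) {A B H : Matrix X X ℂ}
    (hA : A.IsHermitian) (hB : B.IsHermitian) (hH : H.IsHermitian) :
    freeEnergy β A + freeEnergy β B ≤ 2 * freeEnergy β H + ‖A + B - 2 • H‖ := by
  have half_pos : (0 : ℝ) ≤ 1 / 2 := by norm_num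
  have half_add_half : (1 / 2 : ℝ) + 1 / 2 = 1 := by norm_num
  have midpoint := (concaveOn_freeEnergy β).2 hA hB half_pos half_pos half_add_half
  have lipschitz := freeEnergy_le_add_norm_sub hβ
    ((concaveOn_freeEnergy β).1 hA hB half_pos half_pos half_add_half) hH
  have sub_eq : (1 / 2 : ℝ) • A + (1 / 2 : ℝ) • B - H = (1 / 2 : ℝ) • (A + B - 2 • H) := by
    module
  rw [sub_eq, norm_smul, Real.norm_of_nonneg half_pos] at lipschitz
  simp only [smul_eq_mul] at midpoint
  linarith

end FreeEnergy

section UnitaryConjugation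

variable {A : Type*} [NormedRing A] [StarRing A] [CStarRing A]

lemma norm_commutator_le {R : Type*} [NormedRing R] (a b : R) :
    ‖a * b - b * a‖ ≤ 2 * ‖a - 1‖ * ‖b‖ := by
  have centred : a * b - b * a = (a - 1) * b - b * (a - 1) := by noncomm_ring
  rw [centred]
  have := norm_mul_le (a - 1) b
  have := norm_mul_le b (a - 1)
  linarith [norm_sub_le ((a - 1) * b) (b * (a - 1))]

-- The sum of the two conjugates deviates from `2m` by a double commutator with `w - 1`.
lemma norm_star_conj_add_conj_sub_le {w : A} (hw : w ∈ unitary A) (m : A) :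
    ‖star w * m * w + w * m * star w - 2 • m‖ ≤ 4 * ‖w - 1‖ ^ 2 * ‖m‖ := by
  have star_mul_self : star w * w = 1 := Unitary.star_mul_self_of_mem hw
  have mul_star_self : w * star w = 1 := Unitary.mul_star_self_of_mem hw
  set c := w * m - m * w with hc
  have double_commutator :
      star w * m * w + w * m * star w - 2 • m = star w * (w * c - c * w) * star w := by
    have expand : star w * (w * c - c * w) * star w =
        (star w * w) * (w * m * star w) - (star w * w) * m * (w * star w)
          - (star w * w) * m * (w * star w) + star w * m * w * (w * star w) := by
      rw [hc]; noncomm_ring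
    rw [expand, star_mul_self, mul_star_self]
    noncomm_ring
  rw [double_commutator, CStarRing.norm_mul_mem_unitary _ (Unitary.star_mem hw),
    CStarRing.norm_mem_unitary_mul _ (Unitary.star_mem hw)]
  calc ‖w * c - c * w‖ ≤ 2 * ‖w - 1‖ * ‖c‖ := norm_commutator_le w c
    _ ≤ 2 * ‖w - 1‖ * (2 * ‖w - 1‖ * ‖m‖) := by gcongr; exact norm_commutator_le w m
    _ = 4 * ‖w - 1‖ ^ 2 * ‖m‖ := by ring

end UnitaryConjugation

section TensorProducts

open scoped Matrix.Norms.L2Operator Kronecker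

section ProdOp

variable {X ι : Type*} [Fintype X]

/-- The tensor product `⊗_{x ∈ X} u_x` of single-site operators. -/
def prodOp (u : X → Matrix ι ι ℂ) : Op X ι := fun σ τ => ∏ x, u x (σ x) (τ x)

lemma prodOp_conjTranspose (u : X → Matrix ι ι ℂ) :
    (prodOp u)ᴴ = prodOp fun x => (u x)ᴴ := by
  ext σ τ
  simp [prodOp, Matrix.conjTranspose_apply]

lemma prodOp_smul (c : X → ℂ) (u : X → Matrix ι ι ℂ) :
    prodOp (fun x => c x • u x) = (∏ x, c x) • prodOp u := by
  ext σ τ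
  simp [prodOp, Finset.prod_mul_distrib]

lemma prodOp_update_apply [DecidableEq X] (u : X → Matrix ι ι ℂ) (x : X) (M : Matrix ι ι ℂ)
    (σ τ : X → ι) :
    prodOp (Function.update u x M) σ τ =
      M (σ x) (τ x) * ∏ y ∈ Finset.univ.erase x, u y (σ y) (τ y) := by
  rw [prodOp, ← Finset.mul_prod_erase _ _ (Finset.mem_univ x), Function.update_self]
  congr 1
  exact Finset.prod_congr rfl fun y hy => by
    rw [Function.update_of_ne (Finset.ne_of_mem_erase hy)]

lemma prodOp_one [DecidableEq ι] :
    prodOp (fun _ : X => (1 : Matrix ι ι ℂ)) = 1 := by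
  ext σ τ
  rw [prodOp, Matrix.one_apply]
  split_ifs with h
  · subst h
    exact Finset.prod_eq_one fun x _ => Matrix.one_apply_eq _
  · obtain ⟨x, hx⟩ := Function.ne_iff.1 h
    exact Finset.prod_eq_zero (Finset.mem_univ x) (Matrix.one_apply_ne hx)

variable [DecidableEq X] [Fintype ι]

lemma prodOp_mul (u v : X → Matrix ι ι ℂ) :
    prodOp u * prodOp v = prodOp fun x => u x * v x := by
  ext σ τ
  simp only [prodOp, Matrix.mul_apply, Finset.prod_univ_sum, Fintype.piFinset_univ,
    Finset.prod_mul_distrib]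

variable [DecidableEq ι]

lemma prodOp_mem_unitaryGroup {u : X → Matrix ι ι ℂ} (hu : ∀ x, u x ∈ unitaryGroup ι ℂ) :
    prodOp u ∈ unitaryGroup (X → ι) ℂ := by
  rw [Matrix.mem_unitaryGroup_iff, Matrix.star_eq_conjTranspose, prodOp_conjTranspose, prodOp_mul,
    ← prodOp_one]
  exact congrArg prodOp (funext fun x => Unitary.mul_star_self_of_mem (hu x))

/-- The single-site operator `M` acting at the site `x`, as a homomorphism of star algebras. -/
def siteHom (x : X) : Matrix ι ι ℂ →⋆ₙₐ[ℂ] Op X ι where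
  toFun M := prodOp (Function.update (fun _ => 1) x M)
  map_smul' c M := by ext σ τ; simp [prodOp_update_apply, mul_assoc]
  map_zero' := by ext σ τ; simp [prodOp_update_apply]
  map_add' M M' := by ext σ τ; simp [prodOp_update_apply, add_mul]
  map_mul' M M' := by
    rw [prodOp_mul]
    congr 1; ext1 y
    rcases eq_or_ne y x with rfl | h <;> simp [*]
  map_star' M := by
    rw [Matrix.star_eq_conjTranspose, Matrix.star_eq_conjTranspose, prodOp_conjTranspose]
    congr 1; ext1 y
    rcases eq_or_ne y x with rfl | h <;> simp [*]

lemma siteHom_one (x : X) : siteHom x (1 : Matrix ι ι ℂ) = 1 := by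
  change prodOp (Function.update (fun _ => 1) x 1) = (1 : Op X ι)
  rw [Function.update_eq_self, prodOp_one]

lemma prodOp_ite_insert {a : X} {s : Finset X} (ha : a ∉ s) (w : X → Matrix ι ι ℂ) :
    prodOp (fun x => if x ∈ insert a s then w x else 1) =
      prodOp (fun x => if x ∈ s then w x else 1) * siteHom a (w a) := by
  change _ = _ * prodOp (Function.update (fun _ => 1) a (w a))
  rw [prodOp_mul]
  congr 1; ext1 y
  rcases eq_or_ne y a with rfl | h
  · simp [ha]
  · simp [h]

lemma norm_prodOp_sub_one_le {w : X → Matrix ι ι ℂ} (hw : ∀ x, w x ∈ unitaryGroup ι ℂ) :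
    ‖prodOp w - 1‖ ≤ ∑ x, ‖w x - 1‖ := by
  suffices partial_product : ∀ s : Finset X,
      ‖prodOp (fun x => if x ∈ s then w x else 1) - 1‖ ≤ ∑ x ∈ s, ‖w x - 1‖ by
    simpa only [Finset.mem_univ, if_true] using partial_product Finset.univ
  intro s
  induction s using Finset.induction_on with
  | empty => simp [prodOp_one]
  | insert a s ha ih =>
    set V := prodOp fun x => if x ∈ s then w x else 1
    have V_unitary : V ∈ unitaryGroup (X → ι) ℂ :=
      prodOp_mem_unitaryGroup fun x => by
        split_ifs
        exacts [hw x, one_mem _]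
    have telescope : V * siteHom a (w a) - 1 = V * siteHom a (w a - 1) + (V - 1) := by
      rw [map_sub, siteHom_one, mul_sub, mul_one]
      abel
    rw [prodOp_ite_insert ha, telescope, Finset.sum_insert ha]
    refine (norm_add_le _ _).trans (add_le_add ?_ ih)
    rw [CStarRing.norm_mem_unitary_mul _ V_unitary]
    exact NonUnitalStarAlgHom.norm_apply_le _ _

end ProdOp

section Embed

variable {X Y ι : Type*}

lemma embed_isHermitian (f : X → Y) {M : Op X ι} (hM : M.IsHermitian) :
    (embed f M).IsHermitian := by
  classical
  ext σ τ
  have agree_comm : (∀ y ∉ Set.range f, τ y = σ y) ↔ ∀ y ∉ Set.range f, σ y = τ y :=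
    forall₂_congr fun _ _ => eq_comm
  simp only [Matrix.conjTranspose_apply, embed, apply_ite star, star_zero, hM.apply]
  exact if_congr (and_congr_right fun _ => agree_comm) rfl rfl

lemma embed_of_not_injective {f : X → Y} (hf : ¬ Function.Injective f) (M : Op X ι) :
    embed f M = 0 := by
  ext σ τ
  simp [embed, hf]

/-- `embed f` as a linear map. -/
def embedLin (f : X → Y) : Op X ι →ₗ[ℂ] Op Y ι where
  toFun := embed f
  map_smul' c M := by ext σ τ; simp [embed]
  map_add' M M' := by ext σ τ; simp only [embed, Matrix.add_apply]; split_ifs <;> simp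

open Classical in
/-- Splits a configuration into its part on the range of `f` and its part off the range. -/
def splitConfig {f : X → Y} (hf : Function.Injective f) :
    (Y → ι) ≃ (X → ι) × ({y // ¬ y ∈ Set.range f} → ι) :=
  (Equiv.piEquivPiSubtypeProd (fun y => y ∈ Set.range f) fun _ => ι).trans
    (((Equiv.ofInjective f hf).symm.arrowCongr (Equiv.refl ι)).prodCongr (Equiv.refl _))

lemma splitConfig_apply {f : X → Y} (hf : Function.Injective f) (σ : Y → ι) :
    splitConfig hf σ = (σ ∘ f, fun y : {y // ¬ y ∈ Set.range f} => σ y) := rfl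

lemma embed_eq_kronecker [Fintype X] [Fintype Y] [DecidableEq Y] [DecidableEq ι] {f : X → Y}
    (hf : Function.Injective f) (M : Op X ι) :
    embed f M = (M ⊗ₖ (1 : Op {y // ¬ y ∈ Set.range f} ι)).submatrix (splitConfig hf)
      (splitConfig hf) := by
  ext σ τ
  rw [Matrix.submatrix_apply, Matrix.kronecker_apply, splitConfig_apply, splitConfig_apply, embed,
    Matrix.one_apply]
  by_cases h : ∀ y, y ∉ Set.range f → σ y = τ y
  · rw [if_pos ⟨hf, h⟩, if_pos, mul_one]
    ext1 y
    exact h y y.2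
  · rw [if_neg fun H => h H.2, if_neg, mul_zero]
    intro H
    exact h fun y hy => congrFun H ⟨y, hy⟩

variable [Fintype X] [Fintype Y]

lemma prodOp_eq_kronecker [DecidableEq Y] {f : X → Y} (hf : Function.Injective f)
    (u : Y → Matrix ι ι ℂ) :
    prodOp u = (prodOp (fun x => u (f x)) ⊗ₖ
      prodOp (fun y : {y // ¬ y ∈ Set.range f} => u y)).submatrix (splitConfig hf)
      (splitConfig hf) := by
  ext σ τ
  rw [Matrix.submatrix_apply, Matrix.kronecker_apply, splitConfig_apply, splitConfig_apply]
  simp only [prodOp, Function.comp]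
  rw [← Fintype.prod_subtype_mul_prod_subtype (fun y => y ∈ Set.range f)]
  congr 1
  convert ((Equiv.ofInjective f hf).prod_comp
    (fun y : {y // y ∈ Set.range f} => u y (σ y) (τ y))).symm <;> rfl

variable [DecidableEq X] [DecidableEq Y] [Fintype ι] [DecidableEq ι]

/-- `embed f` as a homomorphism of star algebras. -/
def embedHom {f : X → Y} (hf : Function.Injective f) : Op X ι →⋆ₙₐ[ℂ] Op Y ι where
  __ := embedLin f
  map_zero' := map_zero (embedLin f)
  map_mul' M M' := by
    change embed f (M * M') = embed f M * embed f M'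
    rw [embed_eq_kronecker hf, embed_eq_kronecker hf, embed_eq_kronecker hf,
      Matrix.submatrix_mul_equiv, ← Matrix.mul_kronecker_mul, one_mul]
  map_star' M := by
    change embed f (star M) = star (embed f M)
    rw [embed_eq_kronecker hf, embed_eq_kronecker hf, Matrix.star_eq_conjTranspose,
      Matrix.star_eq_conjTranspose, Matrix.conjTranspose_submatrix, Matrix.conjTranspose_kronecker,
      Matrix.conjTranspose_one]

lemma norm_embed_le (f : X → Y) (M : Op X ι) : ‖embed f M‖ ≤ ‖M‖ := by
  by_cases hf : Function.Injective f
  · exact NonUnitalStarAlgHom.norm_apply_le (embedHom hf) M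
  · rw [embed_of_not_injective hf, norm_zero]; exact norm_nonneg _

lemma prodOp_conj_embed {f : X → Y} {u : Y → Matrix ι ι ℂ}
    (hu : ∀ y, u y ∈ unitaryGroup ι ℂ) (M : Op X ι) :
    prodOp u * embed f M * (prodOp u)ᴴ =
      embed f ((prodOp fun x => u (f x)) * M * (prodOp fun x => u (f x))ᴴ) := by
  by_cases hf : Function.Injective f
  · rw [embed_eq_kronecker hf, embed_eq_kronecker hf, prodOp_eq_kronecker hf,
      Matrix.conjTranspose_submatrix, Matrix.conjTranspose_kronecker, Matrix.submatrix_mul_equiv,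
      Matrix.submatrix_mul_equiv, ← Matrix.mul_kronecker_mul, ← Matrix.mul_kronecker_mul, mul_one]
    congr 2
    exact Unitary.mul_star_self_of_mem
      (prodOp_mem_unitaryGroup fun y : {y // ¬ y ∈ Set.range f} => hu y)
  · rw [embed_of_not_injective hf, embed_of_not_injective hf, mul_zero, zero_mul]

end Embed

end TensorProducts

section Rotations

open scoped Matrix.Norms.L2Operator

variable {N : ℕ}

lemma norm_rotate (R : Matrix.specialOrthogonalGroup (Fin N) ℝ) (v : Vec N) :
    ‖rotate R v‖ = ‖v‖ := by
  have transpose_mul : (R : Matrix (Fin N) (Fin N) ℝ)ᵀ * R = 1 :=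
    (Matrix.mem_orthogonalGroup_iff' (Fin N) ℝ).1
      (Matrix.mem_specialOrthogonalGroup_iff.1 R.2).1
  have dot_self (w : Vec N) : ‖w‖ ^ 2 = w.ofLp ⬝ᵥ w.ofLp := by
    rw [EuclideanSpace.real_norm_sq_eq]
    exact Finset.sum_congr rfl fun i _ => sq (w i)
  refine (sq_eq_sq₀ (norm_nonneg _) (norm_nonneg _)).1 ?_
  rw [dot_self, dot_self, rotate, Matrix.dotProduct_mulVec, ← Matrix.mulVec_transpose,
    Matrix.mulVec_mulVec, transpose_mul, Matrix.one_mulVec]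

/-- A generator of rotations by an angle in planes: a skew-symmetric matrix `J` with `J³ = -J`, so
that `-J²` is an orthogonal projection, on whose range `J` is a rotation by a right angle. -/
structure RotationGenerator (N : ℕ) where
  /-- the matrix `J` -/
  J : Matrix (Fin N) (Fin N) ℝ
  transpose_eq : Jᵀ = -J
  cube_eq : J * (J * J) = -J

namespace RotationGenerator

variable (g : RotationGenerator N)

/-- The matrix `exp (t J)` of the rotation by the angle `t`. -/
def rotMatrix (t : ℝ) : Matrix (Fin N) (Fin N) ℝ :=
  1 + Real.sin t • g.J + (1 - Real.cos t) • (g.J * g.J)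

lemma rotMatrix_zero : g.rotMatrix 0 = 1 := by simp [rotMatrix]

lemma rotMatrix_add (s t : ℝ) : g.rotMatrix (s + t) = g.rotMatrix s * g.rotMatrix t := by
  simp only [rotMatrix, add_mul, mul_add, one_mul, mul_one, Matrix.smul_mul, Matrix.mul_smul,
    mul_assoc, g.cube_eq, mul_neg, Real.sin_add, Real.cos_add]
  module

lemma rotMatrix_transpose (t : ℝ) : (g.rotMatrix t)ᵀ = g.rotMatrix (-t) := by
  simp [rotMatrix, g.transpose_eq]

lemma rotMatrix_mul_transpose (t : ℝ) : g.rotMatrix t * (g.rotMatrix t)ᵀ = 1 := by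
  rw [rotMatrix_transpose, ← rotMatrix_add, add_neg_cancel, rotMatrix_zero]

-- The determinant of an orthogonal matrix is `±1`, and a rotation is the square of another one.
lemma det_rotMatrix (t : ℝ) : (g.rotMatrix t).det = 1 := by
  have det_mul_self : (g.rotMatrix (t / 2)).det * (g.rotMatrix (t / 2)).det = 1 := by
    simpa only [Matrix.det_mul, Matrix.det_transpose, Matrix.det_one] using
      congrArg Matrix.det (g.rotMatrix_mul_transpose (t / 2))
  rw [← det_mul_self, ← Matrix.det_mul, ← rotMatrix_add, add_halves]

/-- The rotation by the angle `t`. -/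
def rot (t : ℝ) : Matrix.specialOrthogonalGroup (Fin N) ℝ :=
  ⟨g.rotMatrix t, Matrix.mem_specialOrthogonalGroup_iff.2
    ⟨(Matrix.mem_orthogonalGroup_iff _ _).2 (g.rotMatrix_mul_transpose t), g.det_rotMatrix t⟩⟩

lemma rot_zero : g.rot 0 = 1 := Subtype.ext g.rotMatrix_zero

lemma rot_add (s t : ℝ) : g.rot (s + t) = g.rot s * g.rot t := Subtype.ext (g.rotMatrix_add s t)

lemma norm_J_mul_J : ‖g.J * g.J‖ = ‖g.J‖ * ‖g.J‖ := by
  have := l2_opNorm_conjTranspose_mul_self g.J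
  rwa [Matrix.conjTranspose_eq_transpose_of_trivial, g.transpose_eq, neg_mul, norm_neg] at this

lemma norm_J_le_one : ‖g.J‖ ≤ 1 := by
  have square_le : ‖g.J * g.J‖ * ‖g.J * g.J‖ = ‖g.J * g.J‖ := by
    have := l2_opNorm_conjTranspose_mul_self (g.J * g.J)
    rwa [Matrix.conjTranspose_eq_transpose_of_trivial, Matrix.transpose_mul, g.transpose_eq,
      neg_mul_neg, mul_assoc, g.cube_eq, mul_neg, norm_neg, eq_comm] at this
  rw [norm_J_mul_J] at square_le
  by_contra! h
  have : 1 < ‖g.J‖ * ‖g.J‖ := one_lt_mul_of_lt_of_le h h.le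
  nlinarith

lemma norm_rotMatrix_sub_one_le (t : ℝ) : ‖g.rotMatrix t - 1‖ ≤ 2 * |t| := by
  have split : g.rotMatrix t - 1 = Real.sin t • g.J + (1 - Real.cos t) • (g.J * g.J) := by
    rw [rotMatrix]; abel
  have sin_le : |Real.sin t| ≤ |t| := Real.abs_sin_le_abs
  have cos_le : |1 - Real.cos t| ≤ |t| := by
    simpa [abs_sub_comm] using Real.abs_cos_sub_cos_le t 0
  have J_sq_le : ‖g.J * g.J‖ ≤ 1 := by
    rw [norm_J_mul_J]
    exact mul_le_one₀ g.norm_J_le_one (norm_nonneg _) g.norm_J_le_one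
  calc ‖g.rotMatrix t - 1‖
      ≤ |Real.sin t| * ‖g.J‖ + |1 - Real.cos t| * ‖g.J * g.J‖ := by
        rw [split]
        refine (norm_add_le _ _).trans_eq ?_
        rw [norm_smul, norm_smul, Real.norm_eq_abs, Real.norm_eq_abs]
    _ ≤ |t| * 1 + |t| * 1 := by gcongr; exact g.norm_J_le_one
    _ = 2 * |t| := by ring

lemma rotate_rot_eq_neg {e : Vec N} (he : (g.J * g.J) *ᵥ e.ofLp = -e.ofLp) {t : ℝ}
    (hsin : Real.sin t = 0) (hcos : Real.cos t = -1) : rotate (g.rot t) e = -e := by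
  ext i
  simp only [rotate, rot, rotMatrix, hsin, hcos, zero_smul, add_zero, Matrix.add_mulVec,
    Matrix.one_mulVec, Matrix.smul_mulVec, he, Pi.add_apply, Pi.smul_apply, Pi.neg_apply,
    smul_eq_mul, PiLp.neg_apply]
  ring

end RotationGenerator

lemma exists_unit_orthogonal {E : Type*} [NormedAddCommGroup E] [InnerProductSpace ℝ E]
    [FiniteDimensional ℝ E] (hE : 2 ≤ Module.finrank ℝ E) (e : E) :
    ∃ f : E, ‖f‖ = 1 ∧ inner ℝ e f = 0 := by
  have span_le : Module.finrank ℝ (Submodule.span ℝ {e}) ≤ 1 := by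
    simpa using finrank_span_le_card (R := ℝ) ({e} : Set E)
  have orthogonal_pos : 0 < Module.finrank ℝ (Submodule.span ℝ {e})ᗮ := by
    have := (Submodule.span ℝ {e}).finrank_add_finrank_orthogonal
    omega
  obtain ⟨⟨f, hf⟩, hf0⟩ := Module.finrank_pos_iff_exists_ne_zero.1 orthogonal_pos
  have f_ne : f ≠ 0 := fun h => hf0 (Subtype.ext h)
  have e_orth : inner ℝ e f = 0 :=
    (Submodule.mem_orthogonal _ _).1 hf e (Submodule.mem_span_singleton_self e)
  exact ⟨‖f‖⁻¹ • f, norm_smul_inv_norm (𝕜 := ℝ) f_ne, by rw [inner_smul_right, e_orth, mul_zero]⟩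

-- For a unit vector `f` orthogonal to `e`, the generator of the rotations in the plane of `e` and
-- `f` is `f eᵀ - e fᵀ`.
lemma exists_rotationGenerator (hN : 2 ≤ N) {e : Vec N} (he : ‖e‖ = 1) :
    ∃ g : RotationGenerator N, (g.J * g.J) *ᵥ e.ofLp = -e.ofLp := by
  obtain ⟨f, hf, hef⟩ := exists_unit_orthogonal (by simpa using hN) e
  have dot (v w : Vec N) : v.ofLp ⬝ᵥ w.ofLp = inner ℝ v w := by
    rw [EuclideanSpace.inner_eq_star_dotProduct, dotProduct_comm]; rfl
  have ee : e.ofLp ⬝ᵥ e.ofLp = 1 := by rw [dot, real_inner_self_eq_norm_sq, he, one_pow]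
  have ff : f.ofLp ⬝ᵥ f.ofLp = 1 := by rw [dot, real_inner_self_eq_norm_sq, hf, one_pow]
  have ef : e.ofLp ⬝ᵥ f.ofLp = 0 := by rw [dot, hef]
  have fe : f.ofLp ⬝ᵥ e.ofLp = 0 := by rw [dotProduct_comm, ef]
  refine ⟨⟨vecMulVec f.ofLp e.ofLp - vecMulVec e.ofLp f.ofLp, ?_, ?_⟩, ?_⟩
  · simp [transpose_vecMulVec]
  · simp [mul_sub, sub_mul, vecMulVec_mul_vecMulVec, ee, ff, ef, fe]
    abel
  · rw [← Matrix.mulVec_mulVec]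
    simp [Matrix.sub_mulVec, vecMulVec_mulVec, ee, ff, ef, fe]

end Rotations

section OneParameterGroups

variable {A : Type*} [NormedRing A] [NormedAlgebra ℝ A]

lemma norm_sub_one_le_inv_of_pow {x : A} {n : ℕ} (hn : 0 < n)
    (hx : ∀ k ≤ n, ‖x ^ k - 1‖ ≤ 1 / 2) : ‖x - 1‖ ≤ 1 / n := by
  have geometric : (n : ℝ) • (x - 1) =
      (x ^ n - 1) - (∑ k ∈ Finset.range n, (x ^ k - 1)) * (x - 1) := by
    rw [Finset.sum_sub_distrib, sub_mul, geom_sum_mul, Finset.sum_const, Finset.card_range,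
      nsmul_one, sub_sub_cancel, Nat.cast_smul_eq_nsmul, nsmul_eq_mul]
  have sum_le : ‖∑ k ∈ Finset.range n, (x ^ k - 1)‖ ≤ n * (1 / 2) := by
    simpa using norm_sum_le_of_le _ fun k hk => hx k (Finset.mem_range.1 hk).le
  have bootstrap : n * ‖x - 1‖ ≤ 1 / 2 + n * (1 / 2) * ‖x - 1‖ := by
    calc n * ‖x - 1‖ = ‖(n : ℝ) • (x - 1)‖ := by simp [norm_smul]
      _ ≤ ‖x ^ n - 1‖ + ‖(∑ k ∈ Finset.range n, (x ^ k - 1)) * (x - 1)‖ := by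
        rw [geometric]; exact norm_sub_le _ _
      _ ≤ _ := by
        gcongr
        · exact hx n le_rfl
        · exact (norm_mul_le _ _).trans (by gcongr)
  rw [le_div_iff₀ (by positivity)]
  linarith

lemma norm_oneParameter_sub_one_le {α : ℝ → A} (map_zero : α 0 = 1)
    (map_add : ∀ s t, α (s + t) = α s * α t) (bounded : ∀ s, ‖α s - 1‖ ≤ 2) {a : ℝ} (ha : 0 < a)
    (near : ∀ s, |s| ≤ a → ‖α s - 1‖ ≤ 1 / 2) (t : ℝ) : ‖α t - 1‖ ≤ 2 / a * |t| := by
  rcases lt_or_ge a |t| with large | small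
  · calc ‖α t - 1‖ ≤ 2 / a * a := by rw [div_mul_cancel₀ _ ha.ne']; exact bounded t
      _ ≤ 2 / a * |t| := by gcongr
  rcases eq_or_ne t 0 with rfl | ht
  · simp [map_zero]
  have abs_pos : 0 < |t| := abs_pos.2 ht
  have pow_eq (k : ℕ) : α t ^ k = α (k * t) := by
    induction k with
    | zero => simp [map_zero]
    | succ k ih => rw [pow_succ, ih, ← map_add, Nat.cast_succ, add_one_mul]
  set n := ⌊a / |t|⌋₊
  have n_pos : 0 < n := Nat.floor_pos.2 ((one_le_div abs_pos).2 small)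
  have n_le : (n : ℝ) * |t| ≤ a := (le_div_iff₀ abs_pos).1 (Nat.floor_le (by positivity))
  have le_two_n : a / |t| ≤ 2 * n := by
    have : (1 : ℝ) ≤ n := by exact_mod_cast n_pos
    linarith [Nat.lt_floor_add_one (a / |t|)]
  calc ‖α t - 1‖ ≤ 1 / n := norm_sub_one_le_inv_of_pow n_pos fun k hk => by
        rw [pow_eq]
        refine near _ ?_
        rw [abs_mul, Nat.abs_cast]
        exact le_trans (by gcongr) n_le
    _ = 2 / (2 * n) := by field_simp
    _ ≤ 2 / (a / |t|) := by gcongr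
    _ = 2 / a * |t| := by field_simp

end OneParameterGroups

section Phases

open scoped Matrix.Norms.L2Operator

lemma exists_phase_norm_smul_sub_one_le {A : Type*} [NormedRing A] [StarRing A] [CStarRing A]
    [NormedAlgebra ℂ A] [Nontrivial A] {u : A} (hu : u ∈ unitary A) (z : ℂ) :
    ∃ c : ℂ, ‖c‖ = 1 ∧ ‖c • u - 1‖ ≤ 2 * ‖u - z • 1‖ := by
  obtain ⟨c, norm_c, hc⟩ := RCLike.exists_norm_eq_mul_self z
  have decomposition : c • u - 1 = c • (u - z • 1) + ((‖z‖ : ℂ) - 1) • (1 : A) := by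
    rw [smul_sub, smul_smul, ← hc, sub_smul, one_smul]
    simp
  have modulus : ‖(‖z‖ : ℂ) - 1‖ ≤ ‖u - z • 1‖ := by
    have := abs_norm_sub_norm_le u (z • 1)
    rwa [CStarRing.norm_of_mem_unitary hu, norm_smul, CStarRing.norm_one, mul_one, abs_sub_comm,
      ← Real.norm_eq_abs, ← Complex.norm_real, Complex.ofReal_sub, Complex.ofReal_one] at this
  refine ⟨c, norm_c, ?_⟩
  calc ‖c • u - 1‖ ≤ ‖u - z • 1‖ + ‖(‖z‖ : ℂ) - 1‖ := by
        rw [decomposition]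
        refine (norm_add_le _ _).trans_eq ?_
        rw [norm_smul, norm_smul, norm_c, CStarRing.norm_one, one_mul, mul_one]
    _ ≤ 2 * ‖u - z • 1‖ := by linarith

variable {ι : Type*} [Fintype ι] [DecidableEq ι]

lemma norm_single_one_le (i j : ι) : ‖Matrix.single i j (1 : ℂ)‖ ≤ 1 := by
  have conj_mul_self := l2_opNorm_conjTranspose_mul_self (Matrix.single i j (1 : ℂ))
  rw [Matrix.conjTranspose_single, star_one, Matrix.single_mul_single_same, mul_one,
    ← Matrix.diagonal_single, l2_opNorm_diagonal, Pi.norm_single, norm_one] at conj_mul_self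
  nlinarith [norm_nonneg (Matrix.single i j (1 : ℂ))]

lemma norm_le_sum_norm_entry (M : Matrix ι ι ℂ) : ‖M‖ ≤ ∑ i, ∑ j, ‖M i j‖ := by
  conv_lhs => rw [Matrix.matrix_eq_sum_single M]
  refine norm_sum_le_of_le _ fun i _ => norm_sum_le_of_le _ fun j _ => ?_
  rw [← mul_one (M i j), ← smul_eq_mul, ← Matrix.smul_single, norm_smul, smul_eq_mul, mul_one]
  exact mul_le_of_le_one_right (norm_nonneg _) (norm_single_one_le i j)

-- The entries of the commutator with the matrix unit `E_{bo}` in the column `o` are the entries of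
-- `A - A_{oo}` in the column `b`.
lemma norm_sub_entry_smul_one_le {A : Matrix ι ι ℂ} {ε : ℝ} (hε : 0 ≤ ε)
    (comm : ∀ M, ‖A * M - M * A‖ ≤ ε * ‖M‖) (o : ι) :
    ‖A - A o o • (1 : Matrix ι ι ℂ)‖ ≤ Fintype.card ι ^ 2 * ε := by
  have entry_le (a b : ι) : ‖(A - A o o • (1 : Matrix ι ι ℂ)) a b‖ ≤ ε := by
    have entry_eq : (A - A o o • (1 : Matrix ι ι ℂ)) a b =
        (A * Matrix.single b o 1 - Matrix.single b o 1 * A : Matrix ι ι ℂ) a o := by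
      rw [Matrix.sub_apply, Matrix.sub_apply, Matrix.mul_single_apply_same, Matrix.smul_apply]
      rcases eq_or_ne a b with rfl | h
      · simp
      · rw [Matrix.single_mul_apply_of_ne _ _ _ _ _ h, Matrix.one_apply_ne h]; simp
    calc ‖(A - A o o • (1 : Matrix ι ι ℂ)) a b‖
        ≤ ‖A * Matrix.single b o 1 - Matrix.single b o 1 * A‖ := by
          rw [entry_eq]; exact norm_entry_le _ a o
      _ ≤ ε * ‖Matrix.single b o (1 : ℂ)‖ := comm _
      _ ≤ ε := mul_le_of_le_one_right hε (norm_single_one_le b o)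
  calc ‖A - A o o • (1 : Matrix ι ι ℂ)‖
      ≤ ∑ a, ∑ b, ‖(A - A o o • (1 : Matrix ι ι ℂ)) a b‖ := norm_le_sum_norm_entry _
    _ ≤ ∑ _a : ι, ∑ _b : ι, ε :=
      Finset.sum_le_sum fun a _ => Finset.sum_le_sum fun b _ => entry_le a b
    _ = Fintype.card ι ^ 2 * ε := by simp; ring

/-- The conjugation `M ↦ U M Uᴴ`. It is insensitive to phases, and thus turns a projective
representation into a representation. -/
def conjCLM (U : Matrix ι ι ℂ) : Matrix ι ι ℂ →L[ℂ] Matrix ι ι ℂ :=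
  ContinuousLinearMap.mulLeftRight ℂ (Matrix ι ι ℂ) U Uᴴ

lemma conjCLM_apply (U M : Matrix ι ι ℂ) : conjCLM U M = U * M * Uᴴ := rfl

lemma conjCLM_one : conjCLM (1 : Matrix ι ι ℂ) = 1 := by
  ext1 M
  simp [conjCLM_apply]

lemma conjCLM_mul (U V : Matrix ι ι ℂ) : conjCLM (U * V) = conjCLM U * conjCLM V := by
  ext1 M
  rw [mul_apply_eq_comp, conjCLM_apply, conjCLM_apply, conjCLM_apply, Matrix.conjTranspose_mul]
  simp only [mul_assoc]

lemma conjCLM_smul {c : ℂ} (hc : ‖c‖ = 1) (U : Matrix ι ι ℂ) : conjCLM (c • U) = conjCLM U := by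
  have mul_star_self : c * star c = 1 := by
    simpa [hc] using Complex.mul_conj' c
  ext1 M
  rw [conjCLM_apply, conjCLM_apply, Matrix.conjTranspose_smul, Matrix.smul_mul, Matrix.smul_mul,
    Matrix.mul_smul, smul_smul, mul_star_self, one_smul]

lemma smul_mem_unitaryGroup {c : ℂ} (hc : ‖c‖ = 1) {U : Matrix ι ι ℂ}
    (hU : U ∈ unitaryGroup ι ℂ) : c • U ∈ unitaryGroup ι ℂ := by
  have conj_one (V : Matrix ι ι ℂ) : conjCLM V 1 = V * star V := by
    rw [conjCLM_apply, mul_one, Matrix.star_eq_conjTranspose]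
  rw [Matrix.mem_unitaryGroup_iff, ← conj_one, conjCLM_smul hc, conj_one,
    Matrix.mem_unitaryGroup_iff.1 hU]

section Unitary

variable {U : Matrix ι ι ℂ} (hU : U ∈ unitaryGroup ι ℂ)
include hU

lemma conjCLM_conjTranspose_mul_self : conjCLM Uᴴ * conjCLM U = 1 := by
  rw [← conjCLM_mul, ← conjCLM_one]
  exact congrArg conjCLM (Unitary.star_mul_self_of_mem hU)

lemma conjCLM_eq_one_of_mul_self (idempotent : conjCLM U * conjCLM U = conjCLM U) :
    conjCLM U = 1 := by
  have inverse := conjCLM_conjTranspose_mul_self hU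
  calc conjCLM U = conjCLM Uᴴ * conjCLM U * conjCLM U := by rw [inverse, one_mul]
    _ = 1 := by rw [mul_assoc, idempotent, inverse]

lemma norm_conjCLM_le : ‖conjCLM U‖ ≤ 1 := by
  refine ContinuousLinearMap.opNorm_le_bound _ zero_le_one fun M => ?_
  rw [conjCLM_apply, one_mul, ← Matrix.star_eq_conjTranspose,
    CStarRing.norm_mul_mem_unitary _ (Unitary.star_mem hU), CStarRing.norm_mem_unitary_mul _ hU]

lemma norm_commutator_le_conjCLM (M : Matrix ι ι ℂ) :
    ‖U * M - M * U‖ ≤ ‖conjCLM U - 1‖ * ‖M‖ := by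
  have factor : U * M - M * U = (conjCLM U - 1) M * U := by
    rw [_root_.sub_apply, conjCLM_apply, one_apply_eq_self, sub_mul, mul_assoc _ Uᴴ U,
      show Uᴴ * U = 1 from Unitary.star_mul_self_of_mem hU, mul_one]
  rw [factor, CStarRing.norm_mul_mem_unitary _ hU]
  exact ContinuousLinearMap.le_opNorm _ _

lemma exists_phase_norm_smul_sub_one_le_conjCLM [Nonempty ι] :
    ∃ c : ℂ, ‖c‖ = 1 ∧ ‖c • U - 1‖ ≤ 2 * Fintype.card ι ^ 2 * ‖conjCLM U - 1‖ := by
  obtain ⟨o⟩ := ‹Nonempty ι›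
  have : Nontrivial (Matrix ι ι ℂ) := haveI : Nonempty ι := ⟨o⟩; inferInstance
  obtain ⟨c, hc, near⟩ := exists_phase_norm_smul_sub_one_le hU (U o o)
  refine ⟨c, hc, near.trans ?_⟩
  rw [mul_assoc]
  gcongr
  exact norm_sub_entry_smul_one_le (norm_nonneg _) (norm_commutator_le_conjCLM hU) o

end Unitary

namespace SymmetricSystem

variable {d N : ℕ} (S : SymmetricSystem d N ι)

lemma conjCLM_rep_mul (R T : Matrix.specialOrthogonalGroup (Fin N) ℝ) :
    conjCLM (S.rep (R * T) : Matrix ι ι ℂ) =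
      conjCLM (S.rep R : Matrix ι ι ℂ) * conjCLM (S.rep T : Matrix ι ι ℂ) := by
  obtain ⟨c, hc, h⟩ := S.rep_mul R T
  rw [h, conjCLM_smul hc, conjCLM_mul]

lemma conjCLM_rep_one : conjCLM (S.rep 1 : Matrix ι ι ℂ) = 1 :=
  conjCLM_eq_one_of_mul_self (S.rep 1).2 (by rw [← S.conjCLM_rep_mul, mul_one])

lemma continuous_conjCLM_rep :
    Continuous fun R : Matrix.specialOrthogonalGroup (Fin N) ℝ =>
      conjCLM (S.rep R : Matrix ι ι ℂ) :=
  continuous_clm_apply.2 fun M => S.rep_continuous M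

lemma exists_conjCLM_rep_near_one :
    ∃ r : ℝ, 0 < r ∧ ∀ R : Matrix.specialOrthogonalGroup (Fin N) ℝ,
      ‖(R : Matrix (Fin N) (Fin N) ℝ) - 1‖ < r →
        ‖conjCLM (S.rep R : Matrix ι ι ℂ) - 1‖ ≤ 1 / 2 := by
  have := Metric.continuous_iff.1 S.continuous_conjCLM_rep 1 (1 / 2) one_half_pos
  simp only [conjCLM_rep_one, Subtype.dist_eq, dist_eq_norm] at this
  obtain ⟨r, hr, near⟩ := this
  exact ⟨r, hr, fun R hR => (near R hR).le⟩

lemma exists_norm_conjCLM_rep_rot_sub_one_le :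
    ∃ C : ℝ, 0 ≤ C ∧ ∀ (g : RotationGenerator N) (t : ℝ),
      ‖conjCLM (S.rep (g.rot t) : Matrix ι ι ℂ) - 1‖ ≤ C * |t| := by
  obtain ⟨r, hr, near⟩ := S.exists_conjCLM_rep_near_one
  refine ⟨2 / (r / 4), by positivity, fun g t => ?_⟩
  refine norm_oneParameter_sub_one_le (α := fun t => conjCLM (S.rep (g.rot t) : Matrix ι ι ℂ))
    ?_ ?_ ?_ (by positivity) ?_ t
  · rw [g.rot_zero, S.conjCLM_rep_one]
  · intro s t
    rw [g.rot_add, S.conjCLM_rep_mul]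
  · intro s
    refine (norm_sub_le _ _).trans ?_
    have := norm_conjCLM_le (S.rep (g.rot s)).2
    have : ‖(1 : Matrix ι ι ℂ →L[ℂ] Matrix ι ι ℂ)‖ ≤ 1 := ContinuousLinearMap.norm_id_le
    linarith
  · intro s hs
    refine near _ ((g.norm_rotMatrix_sub_one_le s).trans_lt ?_)
    linarith

lemma exists_phase_norm_smul_rep_rot_sub_one_le [Nonempty ι] :
    ∃ C : ℝ, 0 ≤ C ∧ ∀ (g : RotationGenerator N) (t : ℝ), ∃ c : ℂ, ‖c‖ = 1 ∧
      ‖c • (S.rep (g.rot t) : Matrix ι ι ℂ) - 1‖ ≤ C * |t| := by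
  obtain ⟨C, hC, lipschitz⟩ := S.exists_norm_conjCLM_rep_rot_sub_one_le
  refine ⟨2 * Fintype.card ι ^ 2 * C, by positivity, fun g t => ?_⟩
  obtain ⟨c, hc, near⟩ := exists_phase_norm_smul_sub_one_le_conjCLM (S.rep (g.rot t)).2
  refine ⟨c, hc, near.trans ?_⟩
  rw [mul_assoc _ C]
  gcongr
  exact lipschitz g t

end SymmetricSystem

end Phases

section Twists

open scoped Matrix.Norms.L2Operator

lemma conjCLM_prodOp_smul {X ι : Type*} [Fintype X] [DecidableEq X] [Fintype ι] [DecidableEq ι]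
    {c : X → ℂ} (hc : ∀ x, ‖c x‖ = 1) (u : X → Matrix ι ι ℂ) :
    conjCLM (prodOp fun x => c x • u x) = conjCLM (prodOp u) := by
  rw [prodOp_smul, conjCLM_smul]
  rw [norm_prod]
  exact Finset.prod_eq_one fun x _ => hc x

lemma embed_add_embed_sub_two_nsmul_embed {X Y ι : Type*} (f : X → Y) (A B M : Op X ι) :
    embed f A + embed f B - 2 • embed f M = embed f (A + B - 2 • M) := by
  change embedLin f A + embedLin f B - 2 • embedLin f M = embedLin f (A + B - 2 • M)
  rw [map_sub, map_add, map_nsmul]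

namespace SymmetricSystem

variable {d N : ℕ} {ι : Type*} [Fintype ι] [DecidableEq ι] (S : SymmetricSystem d N ι)
  (g : RotationGenerator N)

/-- The product of the rotations of the spins at the sites `x` by the angles `θ x`. -/
def spinRot {X : Type*} [Fintype X] (θ : X → ℝ) : Op X ι :=
  prodOp fun x => (S.rep (g.rot (θ x)) : Matrix ι ι ℂ)

variable {X Y : Type*} [Fintype X] [DecidableEq X] [Fintype Y] [DecidableEq Y]

lemma spinRot_mem_unitaryGroup (θ : X → ℝ) : S.spinRot g θ ∈ unitaryGroup (X → ι) ℂ :=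
  prodOp_mem_unitaryGroup fun _ => (S.rep _).2

/-- The action on operators of the rotations of the spins at the sites `x` by the angles `θ x`. -/
def twist (θ : X → ℝ) : Op X ι →L[ℂ] Op X ι := conjCLM (S.spinRot g θ)

lemma twist_const_apply (t : ℝ) (M : Op X ι) :
    S.twist g (fun _ => t) M = tensorPower X (S.rep (g.rot t) : Matrix ι ι ℂ) * M *
      (tensorPower X (S.rep (g.rot t) : Matrix ι ι ℂ))ᴴ := rfl

lemma twist_add (θ φ : X → ℝ) : S.twist g (θ + φ) = S.twist g θ * S.twist g φ := by
  choose c hc h using fun x => S.rep_mul (g.rot (θ x)) (g.rot (φ x))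
  rw [twist, twist, twist, ← conjCLM_mul, spinRot, spinRot, spinRot, prodOp_mul]
  simp only [Pi.add_apply, g.rot_add, h]
  exact conjCLM_prodOp_smul hc _

lemma twist_zero : S.twist g (0 : X → ℝ) = 1 :=
  conjCLM_eq_one_of_mul_self (S.spinRot_mem_unitaryGroup g 0)
    ((S.twist_add g 0 0).symm.trans (by rw [add_zero]; rfl))

lemma twist_embed (θ : Y → ℝ) (f : X → Y) (M : Op X ι) :
    S.twist g θ (embed f M) = embed f (S.twist g (θ ∘ f) M) :=
  prodOp_conj_embed (fun _ => (S.rep _).2) M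

lemma twist_const_Q (t : ℝ) (A : Finset (Site d)) :
    S.twist g (fun _ : A => t) (S.Q A) = S.Q A := by
  have unitary : tensorPower A (S.rep (g.rot t) : Matrix ι ι ℂ) *
      (tensorPower A (S.rep (g.rot t) : Matrix ι ι ℂ))ᴴ = 1 :=
    Unitary.mul_star_self_of_mem (S.spinRot_mem_unitaryGroup g fun _ : A => t)
  conv_lhs => rw [twist_const_apply, ← S.Q_rotate (g.rot t) A]
  rw [← mul_assoc, ← mul_assoc, unitary, one_mul, mul_assoc, unitary, mul_one]

/-- `C` bounds the distance, up to phases, of the rotations of a single spin from the identity. -/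
def PhaseLipschitz (C : ℝ) : Prop :=
  0 ≤ C ∧ ∀ (g : RotationGenerator N) (t : ℝ), ∃ c : ℂ, ‖c‖ = 1 ∧
    ‖c • (S.rep (g.rot t) : Matrix ι ι ℂ) - 1‖ ≤ C * |t|

/-- The second difference of the twists of an operator by the angles `±θ`. The first order effects
of the two twists cancel. -/
def twistDefect (θ : X → ℝ) : Op X ι →L[ℂ] Op X ι := S.twist g θ + S.twist g (-θ) - 2 • 1

lemma twistDefect_apply (θ : X → ℝ) (M : Op X ι) :
    S.twistDefect g θ M = S.twist g θ M + S.twist g (-θ) M - 2 • M := rfl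

variable {S} in
lemma norm_twistDefect_le {C : ℝ} (hC : S.PhaseLipschitz C) (θ : X → ℝ) (M : Op X ι) :
    ‖S.twistDefect g θ M‖ ≤ 4 * (C * ∑ x, |θ x|) ^ 2 * ‖M‖ := by
  choose c hc lipschitz using fun x => hC.2 g (θ x)
  set w : X → Matrix ι ι ℂ := fun x => c x • (S.rep (g.rot (θ x)) : Matrix ι ι ℂ)
  have w_unitary (x : X) : w x ∈ unitaryGroup ι ℂ :=
    smul_mem_unitaryGroup (hc x) (S.rep _).2
  have prodOp_unitary := prodOp_mem_unitaryGroup w_unitary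
  have plus : S.twist g θ = conjCLM (prodOp w) := (conjCLM_prodOp_smul hc _).symm
  have minus : S.twist g (-θ) = conjCLM (prodOp w)ᴴ := by
    have inverse : conjCLM (prodOp w)ᴴ * S.twist g θ = 1 := by
      rw [plus, conjCLM_conjTranspose_mul_self prodOp_unitary]
    calc S.twist g (-θ) = conjCLM (prodOp w)ᴴ * S.twist g θ * S.twist g (-θ) := by
          rw [inverse, one_mul]
      _ = conjCLM (prodOp w)ᴴ := by rw [mul_assoc, ← twist_add, add_neg_cancel, twist_zero, mul_one]
  have norm_le : ‖prodOp w - 1‖ ≤ C * ∑ x, |θ x| := by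
    rw [Finset.mul_sum]
    exact (norm_prodOp_sub_one_le w_unitary).trans (Finset.sum_le_sum fun x _ => lipschitz x)
  calc ‖S.twistDefect g θ M‖
      = ‖star (prodOp w) * M * prodOp w + prodOp w * M * star (prodOp w) - 2 • M‖ := by
        rw [twistDefect_apply, plus, minus, conjCLM_apply, conjCLM_apply,
          Matrix.conjTranspose_conjTranspose, add_comm, Matrix.star_eq_conjTranspose]
    _ ≤ 4 * ‖prodOp w - 1‖ ^ 2 * ‖M‖ := norm_star_conj_add_conj_sub_le prodOp_unitary M
    _ ≤ 4 * (C * ∑ x, |θ x|) ^ 2 * ‖M‖ := by gcongr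

lemma twistDefect_embed (θ : Y → ℝ) (f : X → Y) (M : Op X ι) :
    S.twistDefect g θ (embed f M) = embed f (S.twistDefect g (θ ∘ f) M) := by
  rw [twistDefect_apply, twist_embed, twist_embed, embed_add_embed_sub_two_nsmul_embed]
  rfl

variable {S} in
lemma norm_twistDefect_embed_Q_le {C : ℝ} (hC : S.PhaseLipschitz C) (θ : Y → ℝ)
    {A : Finset (Site d)} (f : A → Y) (t : ℝ) :
    ‖S.twistDefect g θ (embed f (S.Q A))‖ ≤ 4 * (C * ∑ x, |θ (f x) - t|) ^ 2 * ‖S.Q A‖ := by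
  have absorb (φ : A → ℝ) (s : ℝ) : S.twist g φ (S.Q A) = S.twist g (φ - fun _ => s) (S.Q A) := by
    conv_lhs => rw [← sub_add_cancel φ fun _ => s, twist_add, mul_apply_eq_comp, twist_const_Q]
  have shift : S.twistDefect g (θ ∘ f) (S.Q A) =
      S.twistDefect g (θ ∘ f - fun _ => t) (S.Q A) := by
    have neg_shift : -(θ ∘ f - fun _ => t) = -(θ ∘ f) - fun _ => -t := by
      ext x
      simp only [Pi.neg_apply, Pi.sub_apply]
      ring
    rw [twistDefect_apply, twistDefect_apply, neg_shift, ← absorb, ← absorb]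
  rw [twistDefect_embed, shift]
  exact (norm_embed_le f _).trans (norm_twistDefect_le g hC _ _)

end SymmetricSystem

end Twists

section TorusGeometry

namespace SymmetricSystem

variable {d K : ℕ}

lemma mem_box {n : ℕ} {x : Site d} : x ∈ box d n ↔ ∀ i, -(n : ℤ) ≤ x i ∧ x i ≤ n := by
  simp [box]

lemma card_box (n : ℕ) : (box d n).card = (2 * n + 1) ^ d := by
  rw [box, Fintype.card_piFinset_const, Int.card_Icc]
  congr 1
  omega

lemma toTorus_add (x y : Site d) : toTorus d K (x + y) = toTorus d K x + toTorus d K y := by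
  ext1 i
  simp [toTorus]

lemma toTorus_injOn_box : Set.InjOn (toTorus d K) (box d K : Set (Site d)) := by
  intro x hx y hy h
  ext1 i
  have x_bounds := mem_box.1 hx i
  have y_bounds := mem_box.1 hy i
  have dvd_sub : (2 * K + 1 : ℤ) ∣ y i - x i := by
    simpa using (ZMod.intCast_eq_intCast_iff_dvd_sub _ _ _).1 (congrFun h i)
  have := Int.eq_zero_of_abs_lt_dvd dvd_sub (by rw [abs_lt]; omega)
  omega

lemma card_filter_toTorus_add_mem_le (T : Finset (Torus d K)) (a : Site d) :
    ((box d K).filter fun x => toTorus d K (a + x) ∈ T).card ≤ T.card := by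
  refine Finset.card_le_card_of_injOn (fun x => toTorus d K (a + x))
    (fun x hx => (Finset.mem_filter.1 hx).2) fun x hx y hy h => ?_
  simp only [toTorus_add, add_right_inj] at h
  exact toTorus_injOn_box (Finset.mem_filter.1 hx).1 (Finset.mem_filter.1 hy).1 h

lemma card_filter_toTorus_mem_le (T : Finset (Torus d K)) :
    ((box d K).filter fun x => toTorus d K x ∈ T).card ≤ T.card := by
  simpa only [zero_add] using card_filter_toTorus_add_mem_le T 0

/-- The supremum distance to the origin in the periodic cube. -/
def torusNorm (t : Torus d K) : ℕ := Finset.univ.sup fun i => (t i).valMinAbs.natAbs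

lemma torusNorm_le_iff {t : Torus d K} {n : ℕ} :
    torusNorm t ≤ n ↔ ∀ i, (t i).valMinAbs.natAbs ≤ n := by
  simp [torusNorm]

lemma torusNorm_toTorus_le_of_mem_box {n : ℕ} {x : Site d} (hx : x ∈ box d n) :
    torusNorm (toTorus d K x) ≤ n := by
  refine torusNorm_le_iff.2 fun i => ?_
  have minimal : (x i : ZMod (2 * K + 1)).valMinAbs.natAbs ≤ (x i).natAbs :=
    ZMod.natAbs_min_of_le_div_two (2 * K + 1) _ _ (by rw [ZMod.coe_valMinAbs])
      (ZMod.natAbs_valMinAbs_le _)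
  have x_bounds := mem_box.1 hx i
  exact minimal.trans (by omega)

lemma torusNorm_toTorus_le_add_dist (x y : Site d) :
    (torusNorm (toTorus d K x) : ℝ) ≤ torusNorm (toTorus d K y) + dist x y := by
  suffices torusNorm (toTorus d K x) ≤ torusNorm (toTorus d K y) + ⌊dist x y⌋₊ from
    (Nat.cast_le.2 this).trans (by push_cast; gcongr; exact Nat.floor_le dist_nonneg)
  refine torusNorm_le_iff.2 fun i => ?_
  have minimal : (x i : ZMod (2 * K + 1)).valMinAbs.natAbs ≤
      ((y i : ZMod (2 * K + 1)).valMinAbs + (x i - y i)).natAbs :=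
    ZMod.natAbs_min_of_le_div_two (2 * K + 1) _ _ (by push_cast; ring)
      (ZMod.natAbs_valMinAbs_le _)
  have coord_dist : (x i - y i).natAbs ≤ ⌊dist x y⌋₊ := Nat.le_floor <| by
    rw [Nat.cast_natAbs, Int.cast_abs, Int.cast_sub, ← Int.dist_eq]
    exact dist_le_pi_dist x y i
  exact minimal.trans ((Int.natAbs_add_le _ _).trans
    (add_le_add (torusNorm_le_iff.1 (le_refl (torusNorm (toTorus d K y))) i) coord_dist))

lemma abs_torusNorm_toTorus_sub_le (x y : Site d) :
    |(torusNorm (toTorus d K x) : ℝ) - torusNorm (toTorus d K y)| ≤ dist x y := by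
  have forward := torusNorm_toTorus_le_add_dist (K := K) x y
  have backward := torusNorm_toTorus_le_add_dist (K := K) y x
  rw [dist_comm] at backward
  rw [abs_le]
  constructor <;> linarith

/-- The sites of the periodic cube at distance less than `n` from the origin. -/
def torusBall (d K n : ℕ) : Finset (Torus d K) := Finset.univ.filter fun t => torusNorm t < n

lemma mem_torusBall {n : ℕ} {t : Torus d K} : t ∈ torusBall d K n ↔ torusNorm t < n := by
  simp [torusBall]

lemma card_torusBall_le (n : ℕ) : (torusBall d K n).card ≤ (2 * n + 1) ^ d := by
  rw [← card_box]
  refine Finset.card_le_card_of_injOn (fun t i => (t i).valMinAbs) (fun t ht => ?_)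
    fun s _ t _ h => funext fun i => ZMod.injective_valMinAbs (congrFun h i)
  refine mem_box.2 fun i => ?_
  have := torusNorm_le_iff.1 (mem_torusBall.1 ht).le i
  dsimp only
  omega

lemma card_torusBall_le_mul_pow {r L n : ℕ} (hL : 1 ≤ L) (hn : n ≤ 2 * L + 2 * r) :
    ((torusBall d K n).card : ℝ) ≤ (5 + 4 * r) ^ d * L ^ d := by
  have radius_le : 2 * n + 1 ≤ (5 + 4 * r) * L := by nlinarith
  rw [← mul_pow]
  exact_mod_cast (card_torusBall_le n).trans (Nat.pow_le_pow_left radius_le d)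

/-- An angle that increases from `0` on the cube of radius `m` to `π` off the cube of radius
`m + L`. -/
def profile (m L : ℕ) (t : Torus d K) : ℝ :=
  Real.pi * Set.projIcc (0 : ℝ) 1 zero_le_one (((torusNorm t : ℝ) - m) / L)

lemma profile_eq_zero {m L : ℕ} {t : Torus d K} (h : torusNorm t ≤ m) : profile m L t = 0 := by
  have : ((torusNorm t : ℝ) - m) / L ≤ 0 :=
    div_nonpos_of_nonpos_of_nonneg (sub_nonpos.2 (by exact_mod_cast h)) (Nat.cast_nonneg _)
  rw [profile, Set.projIcc_of_le_left _ this, mul_zero]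

lemma profile_eq_pi {m L : ℕ} (hL : 1 ≤ L) {t : Torus d K} (h : m + L ≤ torusNorm t) :
    profile m L t = Real.pi := by
  have : 1 ≤ ((torusNorm t : ℝ) - m) / L := by
    rw [le_div_iff₀ (by exact_mod_cast hL), one_mul, le_sub_iff_add_le, add_comm]
    exact_mod_cast h
  rw [profile, Set.projIcc_of_right_le _ this, mul_one]

lemma abs_profile_toTorus_sub_le (m L : ℕ) (x y : Site d) :
    |profile m L (toTorus d K x) - profile m L (toTorus d K y)| ≤ Real.pi / L * dist x y := by
  rw [profile, profile, ← mul_sub, abs_mul, abs_of_pos Real.pi_pos, div_mul_eq_mul_div,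
    mul_div_assoc]
  refine mul_le_mul_of_nonneg_left ((Set.abs_projIcc_sub_projIcc _).trans ?_) Real.pi_pos.le
  rw [← sub_div, sub_sub_sub_cancel_right, abs_div, Nat.abs_cast]
  gcongr
  exact abs_torusNorm_toTorus_sub_le x y

/-- The sites near which the angle `profile (L + r) L` may fail to be constant, up to distance
`r`. -/
def annulus (d K r L : ℕ) : Finset (Site d) :=
  (box d K).filter fun x => toTorus d K x ∈ torusBall d K (2 * L + 2 * r) ∧ x ∉ box d L

lemma annulus_subset_box (r L : ℕ) : annulus d K r L ⊆ box d K := Finset.filter_subset _ _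

lemma notMem_box_of_mem_annulus {r L : ℕ} {x : Site d} (hx : x ∈ annulus d K r L) :
    x ∉ box d L := (Finset.mem_filter.1 hx).2.2

lemma card_annulus_le {r L : ℕ} (hL : 1 ≤ L) :
    ((annulus d K r L).card : ℝ) ≤ (5 + 4 * r) ^ d * L ^ d := by
  refine le_trans (Nat.cast_le.2 ?_) (card_torusBall_le_mul_pow (K := K) hL le_rfl)
  exact (Finset.card_le_card (Finset.monotone_filter_right _ fun _ _ h => h.1)).trans
    (card_filter_toTorus_mem_le _)

lemma profile_toTorus_add_eq {r L : ℕ} (hL : 1 ≤ L) {x : Site d} (hx : x ∈ box d K)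
    (hx' : x ∉ annulus d K r L) {a : Site d} (ha : dist a 0 ≤ r) :
    profile (L + r) L (toTorus d K (a + x)) = profile (L + r) L (toTorus d K x) := by
  have shift_le : |(torusNorm (toTorus d K (a + x)) : ℝ) - torusNorm (toTorus d K x)| ≤ r := by
    refine (abs_torusNorm_toTorus_sub_le (a + x) x).trans ?_
    rwa [dist_eq_norm, add_sub_cancel_right, ← dist_zero_right]
  have upper : torusNorm (toTorus d K (a + x)) ≤ torusNorm (toTorus d K x) + r := by
    exact_mod_cast sub_le_iff_le_add'.1 (abs_le.1 shift_le).2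
  have lower : torusNorm (toTorus d K x) ≤ torusNorm (toTorus d K (a + x)) + r := by
    exact_mod_cast (neg_le_sub_iff_le_add.1 (abs_le.1 shift_le).1)
  by_cases hxL : x ∈ box d L
  · have near := torusNorm_toTorus_le_of_mem_box (K := K) hxL
    rw [profile_eq_zero (by omega), profile_eq_zero (by omega)]
  · have far : 2 * L + 2 * r ≤ torusNorm (toTorus d K x) := by
      rw [← not_lt, ← mem_torusBall]
      exact fun h => hx' (Finset.mem_filter.2 ⟨hx, h, hxL⟩)
    rw [profile_eq_pi hL (by omega), profile_eq_pi hL (by omega)]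

lemma card_profile_ne_pi_le {r L : ℕ} (hL : 1 ≤ L) :
    (((box d K).filter fun x => profile (L + r) L (toTorus d K x) ≠ Real.pi).card : ℝ) ≤
      (5 + 4 * r) ^ d * L ^ d := by
  refine le_trans (Nat.cast_le.2 ?_)
    (card_torusBall_le_mul_pow (K := K) (n := 2 * L + r) hL (by omega))
  refine le_trans (Finset.card_le_card (Finset.monotone_filter_right _ fun x _ h => ?_))
    (card_filter_toTorus_mem_le _)
  rw [mem_torusBall, ← not_le]
  exact fun far => h (profile_eq_pi hL (by omega))

end SymmetricSystem

end TorusGeometry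

section Interaction

open scoped Matrix.Norms.L2Operator

lemma norm_map_tsum_le {α E F : Type*} [NormedAddCommGroup E] [NormedSpace ℂ E]
    [NormedAddCommGroup F] [NormedSpace ℂ F] [CompleteSpace F] (Φ : E →L[ℂ] F) {f : α → E}
    {b : α → ℝ} (hb : Summable b) (h : ∀ a, ‖Φ (f a)‖ ≤ b a) : ‖Φ (∑' a, f a)‖ ≤ ∑' a, b a := by
  by_cases hf : Summable f
  · rw [Φ.map_tsum hf]
    exact tsum_of_norm_bounded hb.hasSum h
  · rw [tsum_eq_zero_of_not_summable hf, map_zero, norm_zero]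
    exact tsum_nonneg fun a => (norm_nonneg _).trans (h a)

lemma exists_sum_abs_sub_le {α : Type*} {A : Finset α} {f : α → ℝ} {w c : ℝ}
    (hw : ∀ a ∈ A, ∀ b ∈ A, |f a - f b| ≤ w) (p : α → Prop) [DecidablePred p]
    (hc : ∀ a, ¬ p a → f a = c) : ∃ t, ∑ a ∈ A, |f a - t| ≤ (A.filter p).card * w := by
  obtain ⟨t, const, close⟩ : ∃ t, (∀ a ∈ A, ¬ p a → f a = t) ∧ ∀ a ∈ A, |f a - t| ≤ w := by
    by_cases hp : ∃ b ∈ A, ¬ p b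
    · obtain ⟨b, hb, hpb⟩ := hp
      exact ⟨f b, fun a _ ha => (hc a ha).trans (hc b hpb).symm, fun a ha => hw a ha b hb⟩
    · push Not at hp
      rcases A.eq_empty_or_nonempty with rfl | ⟨b, hb⟩
      · exact ⟨0, by simp, by simp⟩
      · exact ⟨f b, fun a ha hpa => absurd (hp a ha) hpa, fun a ha => hw a ha b hb⟩
  refine ⟨t, ?_⟩
  rw [← nsmul_eq_mul, ← Finset.sum_filter_of_ne (p := p) fun a ha h => by
    by_contra hpa
    exact h (by rw [const a ha hpa, sub_self, abs_zero])]
  exact Finset.sum_le_card_nsmul _ _ _ fun a ha => close a (Finset.mem_filter.1 ha).1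

lemma diam_translate {d : ℕ} (x : Site d) (A : Finset (Site d)) :
    Metric.diam (translate x A : Set (Site d)) = Metric.diam (A : Set (Site d)) := by
  rw [translate, Finset.coe_map]
  exact (IsometryEquiv.addRight x).isometry.diam_image _

/-- The sets containing `0`, translated by `x`, are the sets containing `x`. -/
def translateEquiv {d : ℕ} (x : Site d) :
    {A : Finset (Site d) // (0 : Site d) ∈ A} ≃ {A : Finset (Site d) // x ∈ A} where
  toFun A := ⟨translate x A.1, Finset.mem_map.2 ⟨0, A.2, zero_add x⟩⟩
  invFun A := ⟨translate (-x) A.1, Finset.mem_map.2 ⟨x, A.2, add_neg_cancel x⟩⟩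
  left_inv A := by
    ext y
    simp [translate, Finset.mem_map]
  right_inv A := by
    ext y
    simp [translate, Finset.mem_map]

namespace SymmetricSystem

variable {d N : ℕ} {ι : Type*} [Fintype ι] [DecidableEq ι]

lemma finite_setOf_diam_le (r : ℝ) : {A : {A : Finset (Site d) // (0 : Site d) ∈ A} |
    Metric.diam (A.1 : Set (Site d)) ≤ r}.Finite := by
  refine Set.Finite.of_finite_image (f := Subtype.val) ?_ Subtype.val_injective.injOn
  refine (box d ⌊r⌋₊).powerset.finite_toSet.subset ?_
  rintro _ ⟨A, hA, rfl⟩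
  refine Finset.mem_coe.2 (Finset.mem_powerset.2 fun x hx => mem_box.2 fun i => ?_)
  have dist_le : dist x 0 ≤ r :=
    (Metric.dist_le_diam_of_mem (Set.Finite.isBounded A.1.finite_toSet) hx A.2).trans hA
  have coord_le : ((x i).natAbs : ℝ) ≤ r := by
    simpa only [Pi.zero_apply, Int.dist_eq, Int.cast_zero, sub_zero, Nat.cast_natAbs,
      Int.cast_abs] using (dist_le_pi_dist x 0 i).trans dist_le
  have := Nat.le_floor coord_le
  omega

lemma FiniteRange.shortRange {S : SymmetricSystem d N ι} (h : S.FiniteRange) : S.ShortRange := by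
  obtain ⟨r, hr⟩ := h
  refine summable_of_ne_finset_zero (s := (finite_setOf_diam_le r).toFinset) fun A hA => ?_
  rw [Set.Finite.mem_toFinset, Set.mem_ofPred_eq, not_le] at hA
  simp [hr A.1 hA, opNorm]

lemma sum_card_filter_toTorus_add_mem_le {K : ℕ} (T : Finset (Torus d K)) (A : Finset (Site d)) :
    ∑ x ∈ box d K, (A.filter fun a => toTorus d K (a + x) ∈ T).card ≤ A.card * T.card := by
  simp only [Finset.card_filter]
  rw [Finset.sum_comm]
  refine Finset.sum_le_card_nsmul _ _ T.card fun a _ => ?_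
  rw [← Finset.card_filter]
  exact card_filter_toTorus_add_mem_le T a

variable (S : SymmetricSystem d N ι)

lemma norm_Q_translate_le (x : Site d) (A : Finset (Site d)) : ‖S.Q (translate x A)‖ ≤ ‖S.Q A‖ := by
  set shift : A → translate x A := fun a => ⟨a + x, add_mem_translate x a⟩
  have injective : Function.Injective shift := fun a b hab =>
    Subtype.ext (add_right_cancel (congrArg Subtype.val hab))
  have surjective (y) : y ∈ Set.range shift := by
    obtain ⟨a, ha, hay⟩ := Finset.mem_map.1 y.2
    exact ⟨⟨a, ha⟩, Subtype.ext hay⟩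
  have Q_eq : S.Q (translate x A) = embed shift (S.Q A) := by
    ext σ τ
    rw [S.Q_translate, embed, if_pos ⟨injective, fun y hy => absurd (surjective y) hy⟩]
    rfl
  rw [Q_eq]
  exact norm_embed_le shift _

/-- The sum `∑_{A ∋ 0} (diam A)² |A| ‖Q_A‖`. -/
def strength : ℝ := ∑' A : {A : Finset (Site d) // (0 : Site d) ∈ A},
  Metric.diam (A.1 : Set (Site d)) ^ 2 * A.1.card * ‖S.Q A.1‖

lemma strength_nonneg : 0 ≤ S.strength := tsum_nonneg fun _ => by positivity

variable {S} (g : RotationGenerator N) {C : ℝ} (hC : S.PhaseLipschitz C) {K : ℕ}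
  {θ : Torus d K → ℝ} {ℓ : ℝ} (hℓ : 0 ≤ ℓ)
  (hθ : ∀ x y : Site d, |θ (toTorus d K x) - θ (toTorus d K y)| ≤ ℓ * dist x y)
  {T : Finset (Torus d K)} {t₀ : ℝ} (hT : ∀ t, t ∉ T → θ t = t₀)

include hC hℓ hθ hT

lemma norm_twistDefect_smul_embed_Q_le (A : Finset (Site d)) :
    ‖S.twistDefect g θ ((A.card : ℂ)⁻¹ • embed (fun a : A => toTorus d K a) (S.Q A))‖ ≤
      4 * (C * ℓ) ^ 2 * (Metric.diam (A : Set (Site d)) ^ 2 *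
        (A.filter fun a => toTorus d K a ∈ T).card * ‖S.Q A‖) := by
  set D := Metric.diam (A : Set (Site d))
  set n := (A.filter fun a => toTorus d K a ∈ T).card
  obtain ⟨t, ht⟩ : ∃ t, ∑ a : A, |θ (toTorus d K a) - t| ≤ n * (ℓ * D) := by
    refine (exists_sum_abs_sub_le (fun a ha b hb => (hθ a b).trans ?_) _
      fun a ha => hT _ ha).imp fun t ht => (Finset.sum_coe_sort A _).trans_le ht
    exact mul_le_mul_of_nonneg_left
      (Metric.dist_le_diam_of_mem (Set.Finite.isBounded A.finite_toSet) ha hb) hℓ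
  have weight : (A.card : ℝ)⁻¹ * n ≤ 1 :=
    inv_mul_le_one_of_le₀ (by exact_mod_cast Finset.card_filter_le _ _) (Nat.cast_nonneg _)
  have hC0 := hC.1
  rw [map_smul, norm_smul, norm_inv, Complex.norm_natCast]
  calc (A.card : ℝ)⁻¹ * ‖S.twistDefect g θ (embed (fun a : A => toTorus d K a) (S.Q A))‖
      ≤ (A.card : ℝ)⁻¹ * (4 * (C * ∑ a : A, |θ (toTorus d K a) - t|) ^ 2 * ‖S.Q A‖) := by
        gcongr
        exact norm_twistDefect_embed_Q_le g hC θ (fun a : A => toTorus d K a) t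
    _ ≤ (A.card : ℝ)⁻¹ * (4 * (C * (n * (ℓ * D))) ^ 2 * ‖S.Q A‖) := by gcongr
    _ = (A.card : ℝ)⁻¹ * n * (4 * (C * ℓ) ^ 2 * (D ^ 2 * n * ‖S.Q A‖)) := by ring
    _ ≤ 4 * (C * ℓ) ^ 2 * (D ^ 2 * n * ‖S.Q A‖) :=
        mul_le_of_le_one_left (by positivity) weight

omit hC hℓ hθ hT in
lemma ShortRange.summable_filter (hS : S.ShortRange) (p : Site d → Prop) [DecidablePred p] :
    Summable fun A : {A : Finset (Site d) // (0 : Site d) ∈ A} =>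
      Metric.diam (A.1 : Set (Site d)) ^ 2 * (A.1.filter p).card * ‖S.Q A.1‖ := by
  refine Summable.of_nonneg_of_le (fun A => by positivity) (fun A => ?_) hS
  rw [opNorm, ← cstar_norm_def]
  gcongr
  exact Finset.filter_subset _ _

lemma norm_twistDefect_tsum_le (hS : S.ShortRange) (x : Site d) :
    ‖S.twistDefect g θ (∑' A : {A : Finset (Site d) // x ∈ A},
      ((A.1.card : ℂ))⁻¹ • embed (fun a : A.1 => toTorus d K a) (S.Q A.1))‖ ≤
      4 * (C * ℓ) ^ 2 * ∑' A : {A : Finset (Site d) // (0 : Site d) ∈ A},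
        Metric.diam (A.1 : Set (Site d)) ^ 2 *
          (A.1.filter fun a => toTorus d K (a + x) ∈ T).card * ‖S.Q A.1‖ := by
  rw [← (translateEquiv x).tsum_eq, ← tsum_mul_left]
  refine norm_map_tsum_le _ ((hS.summable_filter _).mul_left _) fun A => ?_
  refine (norm_twistDefect_smul_embed_Q_le g hC hℓ hθ hT _).trans ?_
  change 4 * (C * ℓ) ^ 2 * (Metric.diam (translate x A.1 : Set (Site d)) ^ 2 *
    ((translate x A.1).filter fun a => toTorus d K a ∈ T).card * ‖S.Q (translate x A.1)‖) ≤ _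
  rw [diam_translate, translate, Finset.filter_map, Finset.card_map]
  gcongr
  · exact id
  · exact S.norm_Q_translate_le x A.1

lemma norm_twistDefect_interaction_le (hS : S.ShortRange) :
    ‖S.twistDefect g θ (S.interaction K)‖ ≤ 4 * (C * ℓ) ^ 2 * (T.card * S.strength) := by
  have summable (x) := hS.summable_filter fun a => toTorus d K (a + x) ∈ T
  rw [interaction, map_sum]
  refine (norm_sum_le_of_le _ fun x _ => norm_twistDefect_tsum_le g hC hℓ hθ hT hS x).trans ?_
  rw [← Finset.mul_sum, ← Summable.tsum_finsetSum fun x _ => summable x, strength,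
    ← tsum_mul_left (a := (T.card : ℝ))]
  refine mul_le_mul_of_nonneg_left (Summable.tsum_le_tsum (fun A => ?_)
    (summable_sum fun x _ => summable x) (hS.mul_left _)) (by positivity)
  have count : ∑ x ∈ box d K, ((A.1.filter fun a => toTorus d K (a + x) ∈ T).card : ℝ) ≤
      A.1.card * T.card := by
    exact_mod_cast sum_card_filter_toTorus_add_mem_le T A.1
  calc ∑ x ∈ box d K, Metric.diam (A.1 : Set (Site d)) ^ 2 *
          (A.1.filter fun a => toTorus d K (a + x) ∈ T).card * ‖S.Q A.1‖
      = Metric.diam (A.1 : Set (Site d)) ^ 2 *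
          (∑ x ∈ box d K, ((A.1.filter fun a => toTorus d K (a + x) ∈ T).card : ℝ)) *
            ‖S.Q A.1‖ := by rw [Finset.mul_sum, Finset.sum_mul]
    _ ≤ Metric.diam (A.1 : Set (Site d)) ^ 2 * (A.1.card * T.card) * ‖S.Q A.1‖ := by gcongr
    _ = T.card * (Metric.diam (A.1 : Set (Site d)) ^ 2 * A.1.card * ‖S.Q A.1‖) := by ring

end SymmetricSystem

end Interaction

section Fields

open scoped Matrix.Norms.L2Operator

namespace SymmetricSystem

variable {d N : ℕ} {ι : Type*} [Fintype ι] [DecidableEq ι] (S : SymmetricSystem d N ι)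

/-- The component `v · κ` of the vector operator in the direction `v`. -/
def fieldOp (v : Vec N) : Op S.cluster ι := ∑ k, (v k : ℂ) • S.lop k

lemma fieldOp_sub (v w : Vec N) : S.fieldOp (v - w) = S.fieldOp v - S.fieldOp w := by
  simp only [fieldOp, PiLp.sub_apply, Complex.ofReal_sub, sub_smul, Finset.sum_sub_distrib]

lemma fieldOp_isHermitian (v : Vec N) : (S.fieldOp v).IsHermitian := by
  rw [Matrix.IsHermitian, fieldOp, Matrix.conjTranspose_sum]
  refine Finset.sum_congr rfl fun k _ => ?_
  rw [Matrix.conjTranspose_smul, (S.lop_hermitian k).eq, Complex.star_def, Complex.conj_ofReal]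

/-- A Lipschitz constant of `v ↦ v · κ`. -/
def lopBound : ℝ := ∑ k, ‖S.lop k‖

lemma lopBound_nonneg : 0 ≤ S.lopBound := Finset.sum_nonneg fun _ _ => norm_nonneg _

lemma norm_fieldOp_le (v : Vec N) : ‖S.fieldOp v‖ ≤ S.lopBound * ‖v‖ := by
  rw [fieldOp, lopBound, Finset.sum_mul]
  refine norm_sum_le_of_le _ fun k _ => ?_
  rw [norm_smul, Complex.norm_real, mul_comm]
  exact mul_le_mul_of_nonneg_left (PiLp.norm_apply_le v k) (norm_nonneg _)

lemma twist_const_fieldOp (g : RotationGenerator N) (t : ℝ) (v : Vec N) :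
    S.twist g (fun _ => t) (S.fieldOp v) = S.fieldOp (rotate (g.rot t) v) :=
  S.lop_rotate (g.rot t) v

/-- The term of the periodic Hamiltonian which couples the vector operator at `x` to the field
`v`. -/
def siteField (K : ℕ) (x : Site d) (v : Vec N) : Op (Torus d K) ι :=
  embed (fun a : S.cluster => toTorus d K (a + x)) (S.fieldOp v)

variable (K : ℕ) (x : Site d)

lemma siteField_eq_sum (v : Vec N) : S.siteField K x v = ∑ k, (v k : ℂ) • S.lopAt K x k := by
  change embedLin _ (S.fieldOp v) = _
  simp only [fieldOp, map_sum, map_smul]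
  rfl

lemma siteField_sub (v w : Vec N) :
    S.siteField K x (v - w) = S.siteField K x v - S.siteField K x w := by
  rw [siteField, fieldOp_sub]
  exact map_sub (embedLin _) _ _

lemma siteField_isHermitian (v : Vec N) : (S.siteField K x v).IsHermitian :=
  embed_isHermitian _ (S.fieldOp_isHermitian v)

lemma norm_siteField_le (v : Vec N) : ‖S.siteField K x v‖ ≤ S.lopBound * ‖v‖ :=
  (norm_embed_le _ _).trans (S.norm_fieldOp_le v)

/-- The periodic Hamiltonian with the field `v x` at the site `x`. -/
def energy (v : Site d → Vec N) : Op (Torus d K) ι :=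
  S.interaction K + ∑ x ∈ box d K, S.siteField K x (v x)

lemma hamiltonian_eq_energy (ε : ℝ) (h : Vec N) (η : Site d → Vec N) :
    S.hamiltonian ε K h η = S.energy K fun x => h + ε • η x := by
  simp only [hamiltonian, energy, siteField_eq_sum]

lemma interaction_isHermitian : (S.interaction K).IsHermitian := by
  rw [Matrix.IsHermitian, interaction, Matrix.conjTranspose_sum]
  refine Finset.sum_congr rfl fun x _ => ?_
  rw [Matrix.conjTranspose_tsum]
  refine tsum_congr fun A => ?_
  rw [Matrix.conjTranspose_smul, (embed_isHermitian _ (S.Q_hermitian _)).eq, star_inv₀,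
    star_natCast]

lemma energy_isHermitian (v : Site d → Vec N) : (S.energy K v).IsHermitian := by
  refine (S.interaction_isHermitian K).add ?_
  rw [Matrix.IsHermitian, Matrix.conjTranspose_sum]
  exact Finset.sum_congr rfl fun x _ => S.siteField_isHermitian K x _

lemma norm_energy_sub_le (v w : Site d → Vec N) :
    ‖S.energy K v - S.energy K w‖ ≤ S.lopBound * ∑ x ∈ box d K, ‖v x - w x‖ := by
  simp only [energy, add_sub_add_left_eq_sub, ← Finset.sum_sub_distrib, ← siteField_sub,
    Finset.mul_sum]
  exact norm_sum_le_of_le _ fun x _ => S.norm_siteField_le K x _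

lemma abs_freeEnergy_energy_sub_le [Nonempty ι] {β : ENNReal} (hβ : β ≠ 0)
    (v w : Site d → Vec N) : |freeEnergy β (S.energy K v) - freeEnergy β (S.energy K w)| ≤
      S.lopBound * ∑ x ∈ box d K, ‖v x - w x‖ :=
  (abs_freeEnergy_sub_le hβ (S.energy_isHermitian K v) (S.energy_isHermitian K w)).trans
    (S.norm_energy_sub_le K v w)

end SymmetricSystem

end Fields

section RotatedFields

open scoped Matrix.Norms.L2Operator

namespace SymmetricSystem

variable {d N : ℕ} {ι : Type*} [Fintype ι] [DecidableEq ι] (S : SymmetricSystem d N ι)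
  (g : RotationGenerator N)

lemma freeEnergy_twist {X : Type*} [Fintype X] [DecidableEq X] (β : ENNReal) (θ : X → ℝ)
    (M : Op X ι) : freeEnergy β (S.twist g θ M) = freeEnergy β M := by
  have conj := freeEnergy_conj (Unitary.star_mem (S.spinRot_mem_unitaryGroup g θ)) β M
  rwa [Matrix.star_eq_conjTranspose, Matrix.conjTranspose_conjTranspose] at conj

lemma twist_isHermitian {X : Type*} [Fintype X] [DecidableEq X] (θ : X → ℝ) {M : Op X ι}
    (hM : M.IsHermitian) : (S.twist g θ M).IsHermitian :=
  isHermitian_mul_mul_conjTranspose _ hM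

lemma twist_siteField_rotate {K : ℕ} (θ : Torus d K → ℝ) (x : Site d) (t : ℝ) (v : Vec N) :
    S.twist g θ (S.siteField K x (rotate (g.rot t) v)) =
      embed (fun a : S.cluster => toTorus d K (a + x))
        (S.twist g (fun a : S.cluster => θ (toTorus d K (a + x)) + t) (S.fieldOp v)) := by
  have add_const : (fun a : S.cluster => θ (toTorus d K (a + x)) + t) =
      (θ ∘ fun a : S.cluster => toTorus d K (a + x)) + fun _ => t := rfl
  rw [siteField, twist_embed, ← twist_const_fieldOp, add_const, twist_add, mul_apply_eq_comp]

/-- The largest distance from the origin, rounded up, at which the vector operator acts. -/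
def clusterRadius : ℕ := S.cluster.sup fun a => ⌈dist a 0⌉₊

lemma dist_le_clusterRadius {a : Site d} (ha : a ∈ S.cluster) : dist a 0 ≤ S.clusterRadius :=
  (Nat.le_ceil _).trans (Nat.cast_le.2 (Finset.le_sup (f := fun a => ⌈dist a 0⌉₊) ha))

variable {S} {C : ℝ} (hC : S.PhaseLipschitz C) {K : ℕ} {θ : Torus d K → ℝ}

include hC in
lemma norm_twist_siteField_add_le (θ : Torus d K → ℝ) (x : Site d) (v : Vec N) :
    ‖S.twist g θ (S.siteField K x (rotate (g.rot (-θ (toTorus d K x))) v)) +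
        S.twist g (-θ) (S.siteField K x (rotate (g.rot (θ (toTorus d K x))) v)) -
        2 • S.siteField K x v‖ ≤
      4 * (C * ∑ a : S.cluster, |θ (toTorus d K (a + x)) - θ (toTorus d K x)|) ^ 2 *
        (S.lopBound * ‖v‖) := by
  set φ : S.cluster → ℝ := fun a => θ (toTorus d K (a + x)) - θ (toTorus d K x)
  have plus : (fun a : S.cluster => θ (toTorus d K (a + x)) + -θ (toTorus d K x)) = φ :=
    funext fun a => (sub_eq_add_neg _ _).symm
  have minus : (fun a : S.cluster => (-θ) (toTorus d K (a + x)) + θ (toTorus d K x)) = -φ :=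
    funext fun a => by simp only [φ, Pi.neg_apply]; ring
  rw [twist_siteField_rotate, twist_siteField_rotate, plus, minus, siteField,
    embed_add_embed_sub_two_nsmul_embed, ← twistDefect_apply]
  refine (norm_embed_le _ _).trans ((norm_twistDefect_le g hC φ _).trans ?_)
  gcongr
  exact S.norm_fieldOp_le v

variable {ℓ : ℝ} (hℓ : 0 ≤ ℓ)
  (hθ : ∀ x y : Site d, |θ (toTorus d K x) - θ (toTorus d K y)| ≤ ℓ * dist x y)
  {B : Finset (Site d)} (hBK : B ⊆ box d K)
  (hB : ∀ x ∈ box d K, x ∉ B → ∀ a ∈ S.cluster, θ (toTorus d K (a + x)) = θ (toTorus d K x))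

include hθ in
lemma sum_abs_angle_sub_le (hℓ : 0 ≤ ℓ) (x : Site d) :
    ∑ a : S.cluster, |θ (toTorus d K (a + x)) - θ (toTorus d K x)| ≤
      ℓ * (S.cluster.card * S.clusterRadius) := by
  have term (a : S.cluster) :
      |θ (toTorus d K (a + x)) - θ (toTorus d K x)| ≤ ℓ * S.clusterRadius := by
    refine (hθ _ _).trans (mul_le_mul_of_nonneg_left ?_ hℓ)
    rw [dist_eq_norm, add_sub_cancel_right, ← dist_zero_right]
    exact S.dist_le_clusterRadius a.2
  refine (Finset.sum_le_card_nsmul _ _ _ fun a _ => term a).trans_eq ?_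
  rw [Finset.card_univ, Fintype.card_coe, nsmul_eq_mul]
  ring

include hC hℓ hθ hBK hB in
lemma norm_sum_twist_siteField_add_le (v : Site d → Vec N) :
    ‖∑ x ∈ box d K, (S.twist g θ (S.siteField K x (rotate (g.rot (-θ (toTorus d K x))) (v x))) +
        S.twist g (-θ) (S.siteField K x (rotate (g.rot (θ (toTorus d K x))) (v x))) -
        2 • S.siteField K x (v x))‖ ≤
      4 * (C * ℓ) ^ 2 * ((S.cluster.card * S.clusterRadius) ^ 2 * S.lopBound *
        ∑ x ∈ B, ‖v x‖) := by
  have hC0 := hC.1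
  have hlop := S.lopBound_nonneg
  refine (norm_sum_le_of_le _ fun x _ => norm_twist_siteField_add_le g hC θ x (v x)).trans ?_
  rw [← Finset.sum_subset hBK fun x hx hxB => ?_, Finset.mul_sum, Finset.mul_sum]
  · refine Finset.sum_le_sum fun x _ => ?_
    calc 4 * (C * ∑ a : S.cluster, |θ (toTorus d K (a + x)) - θ (toTorus d K x)|) ^ 2 *
          (S.lopBound * ‖v x‖)
        ≤ 4 * (C * (ℓ * (S.cluster.card * S.clusterRadius))) ^ 2 * (S.lopBound * ‖v x‖) := by
          gcongr
          exact sum_abs_angle_sub_le hθ hℓ x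
      _ = _ := by ring
  · rw [Finset.sum_eq_zero fun a _ => by rw [hB x hx hxB a a.2, sub_self, abs_zero]]
    ring

include hC hℓ hθ hBK hB in
lemma freeEnergy_rotate_add_freeEnergy_rotate_le [Nonempty ι] (hS : S.ShortRange)
    {T : Finset (Torus d K)} {t₀ : ℝ} (hT : ∀ t, t ∉ T → θ t = t₀) {β : ENNReal} (hβ : β ≠ 0)
    (v : Site d → Vec N) :
    freeEnergy β (S.energy K fun x => rotate (g.rot (θ (toTorus d K x))) (v x)) +
        freeEnergy β (S.energy K fun x => rotate (g.rot (-θ (toTorus d K x))) (v x)) ≤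
      2 * freeEnergy β (S.energy K v) + 4 * (C * ℓ) ^ 2 * (T.card * S.strength +
        (S.cluster.card * S.clusterRadius) ^ 2 * S.lopBound * ∑ x ∈ B, ‖v x‖) := by
  set backward := S.energy K fun x => rotate (g.rot (-θ (toTorus d K x))) (v x) with h_backward
  set forward := S.energy K fun x => rotate (g.rot (θ (toTorus d K x))) (v x) with h_forward
  have second_difference : S.twist g θ backward + S.twist g (-θ) forward - 2 • S.energy K v =
      S.twistDefect g θ (S.interaction K) + ∑ x ∈ box d K,
        (S.twist g θ (S.siteField K x (rotate (g.rot (-θ (toTorus d K x))) (v x))) +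
          S.twist g (-θ) (S.siteField K x (rotate (g.rot (θ (toTorus d K x))) (v x))) -
          2 • S.siteField K x (v x)) := by
    simp only [h_backward, h_forward, energy, twistDefect_apply, map_add, map_sum, smul_add,
      Finset.smul_sum, Finset.sum_sub_distrib, Finset.sum_add_distrib]
    abel
  have bound := freeEnergy_add_freeEnergy_le hβ
    (S.twist_isHermitian g θ (S.energy_isHermitian K _))
    (S.twist_isHermitian g (-θ) (S.energy_isHermitian K _)) (S.energy_isHermitian K v)
    (A := S.twist g θ backward) (B := S.twist g (-θ) forward)
  rw [freeEnergy_twist, freeEnergy_twist, second_difference] at bound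
  have interaction_le := norm_twistDefect_interaction_le g hC hℓ hθ hT hS
  have field_le := norm_sum_twist_siteField_add_le g hC hℓ hθ hBK hB v
  linarith [norm_add_le_of_le interaction_le field_le]

end SymmetricSystem

end RotatedFields

section Flip

lemma rotate_add {N : ℕ} (R : Matrix.specialOrthogonalGroup (Fin N) ℝ) (v w : Vec N) :
    rotate R (v + w) = rotate R v + rotate R w := by
  ext k; simp [rotate, Matrix.mulVec_add]

lemma rotate_smul {N : ℕ} (R : Matrix.specialOrthogonalGroup (Fin N) ℝ) (c : ℝ) (v : Vec N) :
    rotate R (c • v) = c • rotate R v := by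
  ext k; simp [rotate, Matrix.mulVec_smul]

lemma rotate_neg {N : ℕ} (R : Matrix.specialOrthogonalGroup (Fin N) ℝ) (v : Vec N) :
    rotate R (-v) = -rotate R v := by
  ext k; simp [rotate, Matrix.mulVec_neg]

namespace SymmetricSystem

variable {d N : ℕ} {ι : Type*} [Fintype ι] [DecidableEq ι] (S : SymmetricSystem d N ι)

/-- The free energy in the uniform field `h` and the random fields `η`, with a disorder strength
`a x` which may depend on the site `x`. A site where `a` vanishes carries no random field, so this
covers both `F_K^h(η)` and `F_K^h(r_L η)`. -/
def disorderedFreeEnergy (β : ENNReal) (K : ℕ) (a : Site d → ℝ) (h : Vec N)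
    (η : Site d → Vec N) : ℝ :=
  freeEnergy β (S.energy K fun x => h + a x • η x)

lemma F_eq (β : ENNReal) (ε : ℝ) (K : ℕ) (h : Vec N) (η : Site d → Vec N) :
    S.F β ε K h η = S.disorderedFreeEnergy β K (fun _ => ε) h η := by
  rw [F, hamiltonian_eq_energy, disorderedFreeEnergy]

lemma F_resetField_eq (β : ENNReal) (ε : ℝ) (K : ℕ) (h : Vec N) (L : ℕ) (η : Site d → Vec N) :
    S.F β ε K h (resetField L η) =
      S.disorderedFreeEnergy β K (fun x => if x ∈ box d L then 0 else ε) h η := by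
  simp only [F, hamiltonian_eq_energy, disorderedFreeEnergy, resetField, smul_ite, ite_smul,
    smul_zero, zero_smul]

open Classical in
lemma disorderedFreeEnergy_rotate_le [Nonempty ι] {β : ENNReal} (hβ : β ≠ 0) (K : ℕ)
    (a : Site d → ℝ) (h : Vec N) (η : Site d → Vec N)
    (R : Site d → Matrix.specialOrthogonalGroup (Fin N) ℝ) :
    (S.disorderedFreeEnergy β K a h fun x => rotate (R x) (η x)) ≤
      freeEnergy β (S.energy K fun x => rotate (R x) (-h + a x • η x)) +
        S.lopBound * (((box d K).filter fun x => rotate (R x) h ≠ -h).card * (2 * ‖h‖)) := by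
  have difference (x : Site d) : h + a x • rotate (R x) (η x) -
      rotate (R x) (-h + a x • η x) = h + rotate (R x) h := by
    rw [rotate_add, rotate_neg, rotate_smul]
    abel
  have lipschitz := S.abs_freeEnergy_energy_sub_le K hβ
    (fun x => h + a x • rotate (R x) (η x)) (fun x => rotate (R x) (-h + a x • η x))
  have sum_le : ∑ x ∈ box d K, ‖h + rotate (R x) h‖ ≤
      ((box d K).filter fun x => rotate (R x) h ≠ -h).card * (2 * ‖h‖) := by
    rw [← Finset.sum_filter_of_ne (p := fun x => rotate (R x) h ≠ -h) fun x _ hx hR =>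
      hx (by rw [hR, add_neg_cancel, norm_zero]), ← nsmul_eq_mul]
    refine Finset.sum_le_card_nsmul _ _ _ fun x _ => (norm_add_le _ _).trans_eq ?_
    rw [norm_rotate, two_mul]
  simp only [difference] at lipschitz
  have scaled := mul_le_mul_of_nonneg_left sum_le S.lopBound_nonneg
  rw [disorderedFreeEnergy]
  linarith [(abs_le.1 lipschitz).2]

/-- The angle by which the spins near `x` are rotated: `0` on the cube `[-L, L]^d` and `π` at the
sites at distance more than about `2 * L` from the origin. -/
def farAngle (K L : ℕ) (x : Site d) : ℝ := profile (L + S.clusterRadius) L (toTorus d K x)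

lemma farAngle_eq_zero (K : ℕ) {L : ℕ} {x : Site d} (hx : x ∈ box d L) : S.farAngle K L x = 0 :=
  profile_eq_zero ((torusNorm_toTorus_le_of_mem_box hx).trans (Nat.le_add_right _ _))

/-- The sites outside `[-L, L]^d` at which the rotations by `farAngle` cost energy because the
angle varies over the support of the vector operator. -/
def transitionRegion (K L : ℕ) : Finset (Site d) := annulus d K S.clusterRadius L

variable {S}

lemma exists_freeEnergy_rotate_farAngle_le [Nonempty ι] (hS : S.ShortRange) :
    ∃ C : ℝ, 0 ≤ C ∧ ∀ (g : RotationGenerator N) {β : ENNReal}, β ≠ 0 → ∀ (K : ℕ) {L : ℕ}, 1 ≤ L →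
      ∀ v : Site d → Vec N,
        freeEnergy β (S.energy K fun x => rotate (g.rot (S.farAngle K L x)) (v x)) +
            freeEnergy β (S.energy K fun x => rotate (g.rot (-S.farAngle K L x)) (v x)) ≤
          2 * freeEnergy β (S.energy K v) +
            C * (L ^ d / L ^ 2 + (∑ x ∈ S.transitionRegion K L, ‖v x‖) / L ^ 2) := by
  obtain ⟨C₀, hC₀⟩ : ∃ C, S.PhaseLipschitz C := S.exists_phase_norm_smul_rep_rot_sub_one_le
  set c : ℝ := (5 + 4 * S.clusterRadius) ^ d
  set cluster : ℝ := (S.cluster.card * S.clusterRadius) ^ 2 * S.lopBound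
  have strength_nonneg := S.strength_nonneg
  have cluster_nonneg : 0 ≤ cluster := mul_nonneg (sq_nonneg _) S.lopBound_nonneg
  refine ⟨4 * (C₀ * Real.pi) ^ 2 * (c * S.strength + cluster), by positivity,
    fun g β hβ K L hL v => ?_⟩
  have bound := freeEnergy_rotate_add_freeEnergy_rotate_le g hC₀ (by positivity)
    (abs_profile_toTorus_sub_le (K := K) (L + S.clusterRadius) L)
    (annulus_subset_box S.clusterRadius L)
    (fun x hx hxB a ha => profile_toTorus_add_eq hL hx hxB (S.dist_le_clusterRadius ha)) hS
    (T := torusBall d K (2 * L + S.clusterRadius)) (t₀ := Real.pi)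
    (fun t ht => profile_eq_pi hL (by rw [mem_torusBall] at ht; omega)) hβ v
  have card_le := card_torusBall_le_mul_pow (d := d) (K := K) (r := S.clusterRadius)
    (n := 2 * L + S.clusterRadius) hL (by omega)
  have sum_nonneg : 0 ≤ ∑ x ∈ S.transitionRegion K L, ‖v x‖ :=
    Finset.sum_nonneg fun _ _ => norm_nonneg _
  refine bound.trans (add_le_add_right ?_ _)
  calc _ ≤ 4 * (C₀ * (Real.pi / L)) ^ 2 * (c * L ^ d * S.strength +
        cluster * ∑ x ∈ S.transitionRegion K L, ‖v x‖) := by gcongr; exact le_rfl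
    _ ≤ 4 * (C₀ * (Real.pi / L)) ^ 2 * ((c * S.strength + cluster) * L ^ d +
        (c * S.strength + cluster) * ∑ x ∈ S.transitionRegion K L, ‖v x‖) := by
      rw [mul_right_comm c]
      refine mul_le_mul_of_nonneg_left (add_le_add ?_ ?_) (by positivity)
      · exact mul_le_mul_of_nonneg_right (le_add_of_nonneg_right cluster_nonneg) (by positivity)
      · exact mul_le_mul_of_nonneg_right (le_add_of_nonneg_left (by positivity)) sum_nonneg
    _ = _ := by ring

lemma sum_transitionRegion_norm_le {a : Site d → ℝ} {ε : ℝ} (ha : ∀ x, |a x| ≤ ε) (K : ℕ) {L : ℕ}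
    (hL : 1 ≤ L) (h : Vec N) (η : Site d → Vec N) :
    ∑ x ∈ S.transitionRegion K L, ‖h + a x • η x‖ ≤
      (5 + 4 * S.clusterRadius) ^ d * L ^ d * ‖h‖ +
        ε * ∑ x ∈ S.transitionRegion K L, ‖η x‖ := by
  calc _ ≤ ∑ x ∈ S.transitionRegion K L, (‖h‖ + ε * ‖η x‖) := by
        refine Finset.sum_le_sum fun x _ => (norm_add_le _ _).trans ?_
        rw [norm_smul, Real.norm_eq_abs]
        gcongr
        exact ha x
    _ = (S.transitionRegion K L).card * ‖h‖ + ε * ∑ x ∈ S.transitionRegion K L, ‖η x‖ := by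
        rw [Finset.sum_add_distrib, Finset.sum_const, nsmul_eq_mul, Finset.mul_sum]
    _ ≤ _ := by gcongr; exact card_annulus_le hL

lemma disorderedFreeEnergy_rotate_farAngle_le [Nonempty ι] {β : ENNReal} (hβ : β ≠ 0) (K : ℕ)
    {L : ℕ} (hL : 1 ≤ L) (a : Site d → ℝ) {h : Vec N} (η : Site d → Vec N)
    {R : Site d → Matrix.specialOrthogonalGroup (Fin N) ℝ}
    (hR : ∀ x, S.farAngle K L x = Real.pi → rotate (R x) h = -h) :
    (S.disorderedFreeEnergy β K a h fun x => rotate (R x) (η x)) ≤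
      freeEnergy β (S.energy K fun x => rotate (R x) (-h + a x • η x)) +
        S.lopBound * ((5 + 4 * S.clusterRadius) ^ d * L ^ d * (2 * ‖h‖)) := by
  classical
  have lop_nonneg := S.lopBound_nonneg
  refine (S.disorderedFreeEnergy_rotate_le hβ K a h η R).trans (add_le_add_right ?_ _)
  gcongr
  refine le_trans (Nat.cast_le.2 ?_) (card_profile_ne_pi_le (K := K) hL)
  exact Finset.card_le_card (Finset.monotone_filter_right _ fun x _ hx hπ => hx (hR x hπ))

lemma exists_disorderedFreeEnergy_rotate_farAngle_le [Nonempty ι] (hS : S.ShortRange) {ε : ℝ}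
    (hε : 0 ≤ ε) :
    ∃ C : ℝ, 0 ≤ C ∧ ∀ (g : RotationGenerator N) {h : Vec N},
      (g.J * g.J) *ᵥ h.ofLp = -h.ofLp → ∀ {β : ENNReal}, β ≠ 0 → ∀ (K : ℕ) {L : ℕ}, 1 ≤ L →
      ∀ {a : Site d → ℝ}, (∀ x, |a x| ≤ ε) → ∀ η : Site d → Vec N,
        (S.disorderedFreeEnergy β K a h fun x => rotate (g.rot (S.farAngle K L x)) (η x)) +
            (S.disorderedFreeEnergy β K a h fun x => rotate (g.rot (-S.farAngle K L x)) (η x)) ≤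
          2 * S.disorderedFreeEnergy β K a (-h) η +
            C * (L ^ d / L ^ 2 + L ^ d * ‖h‖ + (∑ x ∈ S.transitionRegion K L, ‖η x‖) / L ^ 2) := by
  obtain ⟨C, hC, rotate_le⟩ := exists_freeEnergy_rotate_farAngle_le hS
  set c : ℝ := (5 + 4 * S.clusterRadius) ^ d with hc
  have lop_nonneg := S.lopBound_nonneg
  refine ⟨C + (C * c + 4 * (S.lopBound * c)) + C * ε, by positivity,
    fun g h hg β hβ K L hL a ha η => ?_⟩
  have one_le : (1 : ℝ) ≤ L ^ 2 := one_le_pow₀ (Nat.one_le_cast.2 hL)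
  set s := ∑ x ∈ S.transitionRegion K L, ‖η x‖
  have : 0 ≤ s := Finset.sum_nonneg fun _ _ => norm_nonneg _
  have twisted := rotate_le g hβ K hL fun x => -h + a x • η x
  have forward := disorderedFreeEnergy_rotate_farAngle_le (S := S) hβ K hL a η
    (R := fun x => g.rot (S.farAngle K L x))
    fun x hx => g.rotate_rot_eq_neg hg (by simp [hx]) (by simp [hx])
  have backward := disorderedFreeEnergy_rotate_farAngle_le (S := S) hβ K hL a η
    (R := fun x => g.rot (-S.farAngle K L x))
    fun x hx => g.rotate_rot_eq_neg hg (by simp [hx]) (by simp [hx])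
  have field_cost : C * ((∑ x ∈ S.transitionRegion K L, ‖-h + a x • η x‖) / L ^ 2) ≤
      C * c * (L ^ d * ‖h‖) + C * ε * (s / L ^ 2) := by
    calc _ ≤ C * ((c * L ^ d * ‖h‖ + ε * s) / L ^ 2) := by
          gcongr
          simpa only [norm_neg] using sum_transitionRegion_norm_le ha K hL (-h) η
      _ = C * c * (L ^ d * ‖h‖) / L ^ 2 + C * ε * (s / L ^ 2) := by ring
      _ ≤ _ := by gcongr; exact div_le_self (by positivity) one_le
  have cross_terms : 0 ≤ C * (L ^ d * ‖h‖ + s / L ^ 2) +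
      (C * c + 4 * (S.lopBound * c)) * (L ^ d / L ^ 2 + s / L ^ 2) +
      C * ε * (L ^ d / L ^ 2 + L ^ d * ‖h‖) := by positivity
  rw [← hc] at forward backward
  change _ ≤ 2 * freeEnergy β (S.energy K fun x => -h + a x • η x) + _
  linarith

end SymmetricSystem

end Flip

section ConditionalExpectation

variable {Ω : Type*} {m mΩ : MeasurableSpace Ω} {P : Measure Ω}

lemma condExp_comp_eq_of_identDistrib {α γ : Type*} [MeasurableSpace α] [MeasurableSpace γ]
    [IsFiniteMeasure P] {X Y : Ω → α} (hXY : IdentDistrib X Y P P) (hY : Measurable Y)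
    {ψ : α → γ} (hψ : Measurable ψ) (hψXY : ψ ∘ X = ψ ∘ Y) {Φ : α → ℝ} (hΦ : Measurable Φ)
    (hint : Integrable (Φ ∘ Y) P) :
    P[Φ ∘ X | MeasurableSpace.comap (ψ ∘ Y) inferInstance] =ᵐ[P]
      P[Φ ∘ Y | MeasurableSpace.comap (ψ ∘ Y) inferInstance] := by
  have le := (hψ.comp hY).comap_le
  refine (ae_eq_condExp_of_forall_setIntegral_eq le ((hXY.comp hΦ).integrable_iff.2 hint)
    (fun s _ _ => integrable_condExp.integrableOn) (fun s hs _ => ?_)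
    stronglyMeasurable_condExp.aestronglyMeasurable).symm
  rw [setIntegral_condExp le hint hs]
  obtain ⟨B, hB, rfl⟩ := hs
  have integral_X := setIntegral_map (hψ hB) hΦ.aestronglyMeasurable hXY.aemeasurable_fst
  have integral_Y := setIntegral_map (hψ hB) hΦ.aestronglyMeasurable hXY.aemeasurable_snd
  rw [hXY.map_eq, integral_Y, ← Set.preimage_comp, ← Set.preimage_comp, hψXY] at integral_X
  exact integral_X

lemma condExp_le_of_add_le {f f₁ f₂ g b : Ω → ℝ} {c : ℝ} (hf₁ : Integrable f₁ P)
    (hf₂ : Integrable f₂ P) (hg : Integrable g P) (hb : Integrable b P)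
    (condExp_f₁ : P[f₁ | m] =ᵐ[P] P[f | m]) (condExp_f₂ : P[f₂ | m] =ᵐ[P] P[f | m])
    (condExp_b : P[b | m] =ᵐ[P] fun _ => c) (h : ∀ ω, f₁ ω + f₂ ω ≤ 2 * g ω + b ω) :
    ∀ᵐ ω ∂P, (P[f | m]) ω ≤ (P[g | m]) ω + c / 2 := by
  filter_upwards [condExp_mono (m := m) (hf₁.add hf₂) ((hg.smul (2 : ℝ)).add hb) (ae_of_all P h),
    condExp_add hf₁ hf₂ m, condExp_add (hg.smul (2 : ℝ)) hb m, condExp_smul (2 : ℝ) g m (μ := P),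
    condExp_f₁, condExp_f₂, condExp_b] with ω mono add₁ add₂ smul eq₁ eq₂ eq_b
  rw [add₁, add₂, Pi.add_apply, Pi.add_apply, smul, Pi.smul_apply, smul_eq_mul, eq₁, eq₂,
    eq_b] at mono
  linarith

lemma abs_sub_integral_le [IsProbabilityMeasure P] {f : Ω → ℝ} {b : ℝ}
    (h : ∀ᵐ ω ∂P, |f ω| ≤ b) : ∀ᵐ ω ∂P, |f ω - ∫ ω', f ω' ∂P| ≤ 2 * b := by
  have integral_le : |∫ ω, f ω ∂P| ≤ b := by
    simpa only [Real.norm_eq_abs, probReal_univ, mul_one] using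
      norm_integral_le_of_norm_le_const (f := f) h
  filter_upwards [h] with ω hω
  linarith [abs_sub (f ω) (∫ ω', f ω' ∂P)]

end ConditionalExpectation

section Disorder

variable {d N : ℕ} {Ω : Type*} [mΩ : MeasurableSpace Ω] {P : Measure Ω}
  {η : Site d → Ω → Vec N} {M : ℝ}

lemma rotate_one (v : Vec N) : rotate 1 v = v := by
  ext k; simp [rotate]

lemma continuous_rotate (R : Matrix.specialOrthogonalGroup (Fin N) ℝ) :
    Continuous (rotate R : Vec N → Vec N) := by
  unfold rotate
  fun_prop

/-- Independent random vectors with rotation invariant distributions, which may differ from site to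
site, and with first absolute moments at most `M`. -/
structure RotationInvariantDisorder (P : Measure Ω) (η : Site d → Ω → Vec N) (M : ℝ) : Prop where
  measurable : ∀ x, Measurable (η x)
  indep : iIndepFun η P
  rotation_invariant : ∀ (R : Matrix.specialOrthogonalGroup (Fin N) ℝ) (x : Site d),
    P.map (fun ω => rotate R (η x ω)) = P.map (η x)
  integrable_norm : ∀ x, Integrable (fun ω => ‖η x ω‖) P
  integral_norm_le : ∀ x, ∫ ω, ‖η x ω‖ ∂P ≤ M

lemma IsotropicDisorder.rotationInvariantDisorder [IsProbabilityMeasure P]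
    (hη : IsotropicDisorder P η) : RotationInvariantDisorder P η (∫ ω, ‖η 0 ω‖ ∂P) where
  measurable := hη.measurable
  indep := hη.indep
  rotation_invariant := hη.rotation_invariant
  integrable_norm x := ((hη.finite_variance x).integrable (by norm_num)).norm
  integral_norm_le x := ((hη.ident x 0).comp measurable_norm).integral_eq.le

/-- The `σ`-algebra generated by the components in the direction `e` of the fields in
`[-L, L]^d`. -/
abbrev componentAlgebra (η : Site d → Ω → Vec N) (e : Vec N) (L : ℕ) : MeasurableSpace Ω :=
  MeasurableSpace.comap (fun ω (x : box d L) => (inner ℝ e (η x ω) : ℝ)) inferInstance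

lemma measurable_inner_comp {X Y : Type*} (e : Vec N) (s : Y → X) :
    Measurable fun (v : X → Vec N) y => (inner ℝ e (v (s y)) : ℝ) :=
  measurable_pi_lambda _ fun y => measurable_const.inner (measurable_pi_apply (s y))

namespace RotationInvariantDisorder

lemma measurable_field (hη : RotationInvariantDisorder P η M) : Measurable fun ω x => η x ω :=
  measurable_pi_lambda _ hη.measurable

lemma componentAlgebra_le (hη : RotationInvariantDisorder P η M) (e : Vec N) (L : ℕ) :
    componentAlgebra η e L ≤ mΩ :=
  ((measurable_inner_comp e Subtype.val).comp hη.measurable_field).comap_le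

lemma identDistrib_rotate [IsProbabilityMeasure P] (hη : RotationInvariantDisorder P η M)
    (R : Site d → Matrix.specialOrthogonalGroup (Fin N) ℝ) :
    IdentDistrib (fun ω x => rotate (R x) (η x ω)) (fun ω x => η x ω) P P := by
  have measurable_rotate (x : Site d) := (continuous_rotate (R x)).measurable
  exact IdentDistrib.pi
    (fun x => ⟨((measurable_rotate x).comp (hη.measurable x)).aemeasurable,
      (hη.measurable x).aemeasurable, hη.rotation_invariant (R x) x⟩)
    (hη.indep.comp _ measurable_rotate) hη.indep

lemma condExp_rotate_eq [IsProbabilityMeasure P] (hη : RotationInvariantDisorder P η M) (e : Vec N)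
    {L : ℕ} {R : Site d → Matrix.specialOrthogonalGroup (Fin N) ℝ} (hR : ∀ x ∈ box d L, R x = 1)
    {Φ : (Site d → Vec N) → ℝ} (hΦ : Measurable Φ)
    (hint : Integrable (fun ω => Φ fun x => η x ω) P) :
    P[fun ω => Φ fun x => rotate (R x) (η x ω) | componentAlgebra η e L] =ᵐ[P]
      P[fun ω => Φ fun x => η x ω | componentAlgebra η e L] := by
  refine condExp_comp_eq_of_identDistrib (hη.identDistrib_rotate R) hη.measurable_field
    (measurable_inner_comp e (Subtype.val : box d L → Site d)) ?_ hΦ hint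
  ext ω x
  simp only [Function.comp_apply, hR x x.2, rotate_one]

lemma condExp_eq_integral_of_disjoint [IsProbabilityMeasure P]
    (hη : RotationInvariantDisorder P η M) (e : Vec N) {L : ℕ} {B : Finset (Site d)}
    (hB : Disjoint B (box d L)) {Φ : (B → Vec N) → ℝ} (hΦ : Measurable Φ) :
    P[fun ω => Φ fun x => η x ω | componentAlgebra η e L] =ᵐ[P]
      fun _ => ∫ ω, Φ (fun x => η x ω) ∂P := by
  have measurable : Measurable fun ω => Φ fun x => η x ω :=
    hΦ.comp (measurable_pi_lambda _ fun x => hη.measurable x)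
  refine condExp_indep_eq measurable.comap_le (hη.componentAlgebra_le e L)
    (comap_measurable _).stronglyMeasurable ?_
  exact (hη.indep.indepFun_finset B (box d L) hB hη.measurable).comp hΦ
    (measurable_inner_comp e id)

lemma condExp_comp_sum_norm_eq_integral [IsProbabilityMeasure P]
    (hη : RotationInvariantDisorder P η M) (e : Vec N) {L : ℕ} {B : Finset (Site d)}
    (hB : Disjoint B (box d L)) {φ : ℝ → ℝ} (hφ : Measurable φ) :
    P[fun ω => φ (∑ x ∈ B, ‖η x ω‖) | componentAlgebra η e L] =ᵐ[P]
      fun _ => ∫ ω, φ (∑ x ∈ B, ‖η x ω‖) ∂P := by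
  have sum_coe_sort (ω : Ω) := Finset.sum_coe_sort B fun x => ‖η x ω‖
  simp only [← sum_coe_sort]
  exact hη.condExp_eq_integral_of_disjoint e hB (Φ := fun v => φ (∑ x, ‖v x‖)) (by fun_prop)

lemma bound_nonneg (hη : RotationInvariantDisorder P η M) : 0 ≤ M :=
  (integral_nonneg fun _ => norm_nonneg _).trans (hη.integral_norm_le 0)

lemma integral_sum_norm_le (hη : RotationInvariantDisorder P η M) (B : Finset (Site d)) :
    ∫ ω, ∑ x ∈ B, ‖η x ω‖ ∂P ≤ B.card * M := by
  rw [integral_finsetSum B fun x _ => hη.integrable_norm x, ← nsmul_eq_mul]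
  exact Finset.sum_le_card_nsmul _ _ _ fun x _ => hη.integral_norm_le x

end RotationInvariantDisorder

namespace SymmetricSystem

variable {ι : Type*} [Fintype ι] [DecidableEq ι] [Nonempty ι] (S : SymmetricSystem d N ι)
  {β : ENNReal}

lemma abs_disorderedFreeEnergy_sub_le (hβ : β ≠ 0) (K : ℕ) (a : Site d → ℝ) (h : Vec N)
    (η η' : Site d → Vec N) :
    |S.disorderedFreeEnergy β K a h η - S.disorderedFreeEnergy β K a h η'| ≤
      S.lopBound * ∑ x ∈ box d K, |a x| * ‖η x - η' x‖ := by
  refine (S.abs_freeEnergy_energy_sub_le K hβ _ _).trans_eq ?_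
  simp only [add_sub_add_left_eq_sub, ← smul_sub, norm_smul, Real.norm_eq_abs]

lemma continuous_disorderedFreeEnergy (hβ : β ≠ 0) (K : ℕ) (a : Site d → ℝ) (h : Vec N) :
    Continuous (S.disorderedFreeEnergy β K a h) := by
  refine continuous_iff_continuousAt.2 fun η => tendsto_iff_norm_sub_tendsto_zero.2 ?_
  refine squeeze_zero (fun _ => norm_nonneg _)
    (fun η' => S.abs_disorderedFreeEnergy_sub_le hβ K a h η' η) ?_
  have bound_continuous : Continuous fun η' : Site d → Vec N =>
      S.lopBound * ∑ x ∈ box d K, |a x| * ‖η' x - η x‖ := by fun_prop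
  simpa using bound_continuous.tendsto η

lemma integrable_disorderedFreeEnergy [IsFiniteMeasure P] (hη : RotationInvariantDisorder P η M)
    (hβ : β ≠ 0) (K : ℕ) (a : Site d → ℝ) (h : Vec N) :
    Integrable (fun ω => S.disorderedFreeEnergy β K a h fun x => η x ω) P := by
  have bound_integrable : Integrable (fun ω => |S.disorderedFreeEnergy β K a h 0| +
      S.lopBound * ∑ x ∈ box d K, |a x| * ‖η x ω‖) P :=
    (integrable_const _).add
      ((integrable_finsetSum _ fun x _ => (hη.integrable_norm x).const_mul _).const_mul _)
  refine bound_integrable.mono' ((S.continuous_disorderedFreeEnergy hβ K a h).measurable.comp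
    hη.measurable_field).aestronglyMeasurable (ae_of_all _ fun ω => ?_)
  have lipschitz := S.abs_disorderedFreeEnergy_sub_le hβ K a h (fun x => η x ω) 0
  simp only [Pi.zero_apply, sub_zero] at lipschitz
  rw [Real.norm_eq_abs]
  linarith [abs_sub_abs_le_abs_sub (S.disorderedFreeEnergy β K a h fun x => η x ω)
    (S.disorderedFreeEnergy β K a h 0)]

lemma integrable_disorderedFreeEnergy_rotate [IsProbabilityMeasure P]
    (hη : RotationInvariantDisorder P η M) (hβ : β ≠ 0) (K : ℕ) (a : Site d → ℝ) (h : Vec N)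
    (R : Site d → Matrix.specialOrthogonalGroup (Fin N) ℝ) :
    Integrable (fun ω => S.disorderedFreeEnergy β K a h fun x => rotate (R x) (η x ω)) P :=
  ((hη.identDistrib_rotate R).comp
    (S.continuous_disorderedFreeEnergy hβ K a h).measurable).integrable_iff.2
    (S.integrable_disorderedFreeEnergy hη hβ K a h)

lemma condExp_disorderedFreeEnergy_rotate_eq [IsProbabilityMeasure P]
    (hη : RotationInvariantDisorder P η M) (hβ : β ≠ 0) (K : ℕ) (a : Site d → ℝ) (h e : Vec N)
    {L : ℕ} {R : Site d → Matrix.specialOrthogonalGroup (Fin N) ℝ}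
    (hR : ∀ x ∈ box d L, R x = 1) :
    P[fun ω => S.disorderedFreeEnergy β K a h fun x => rotate (R x) (η x ω) |
        componentAlgebra η e L] =ᵐ[P]
      P[fun ω => S.disorderedFreeEnergy β K a h fun x => η x ω | componentAlgebra η e L] :=
  hη.condExp_rotate_eq e hR (S.continuous_disorderedFreeEnergy hβ K a h).measurable
    (S.integrable_disorderedFreeEnergy hη hβ K a h)

end SymmetricSystem

end Disorder

section FreeEnergyDifference

variable {d N : ℕ} {ι : Type*} [Fintype ι] [DecidableEq ι] {S : SymmetricSystem d N ι}
  {Ω : Type*} [MeasurableSpace Ω] {P : Measure Ω} [IsProbabilityMeasure P]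
  {η : Site d → Ω → Vec N} {M ε : ℝ}

namespace SymmetricSystem

lemma integral_transitionRegion_cost_le (hη : RotationInvariantDisorder P η M) (K : ℕ) {L : ℕ}
    (hL : 1 ≤ L) {C t : ℝ} (hC : 0 ≤ C) (ht : (L : ℝ) ^ d / L ^ 2 ≤ t) :
    ∫ ω, C * (t + (∑ x ∈ S.transitionRegion K L, ‖η x ω‖) / L ^ 2) ∂P ≤
      C * (1 + (5 + 4 * S.clusterRadius) ^ d * M) * t := by
  set c : ℝ := (5 + 4 * S.clusterRadius) ^ d
  have M_nonneg := hη.bound_nonneg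
  have sum_le : ∫ ω, ∑ x ∈ S.transitionRegion K L, ‖η x ω‖ ∂P ≤ c * L ^ d * M :=
    (hη.integral_sum_norm_le _).trans (mul_le_mul_of_nonneg_right (card_annulus_le hL) M_nonneg)
  rw [integral_const_mul, integral_add (integrable_const t)
    ((integrable_finsetSum _ fun x _ => hη.integrable_norm x).div_const _), integral_div,
    integral_const, probReal_univ, one_smul, mul_assoc]
  gcongr
  calc _ ≤ t + c * L ^ d * M / L ^ 2 := by gcongr
    _ = t + c * M * (L ^ d / L ^ 2) := by ring
    _ ≤ t + c * M * t := by gcongr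
    _ = _ := by ring

variable [Nonempty ι]

lemma exists_condExp_disorderedFreeEnergy_le (hN : 2 ≤ N) (hS : S.ShortRange)
    (hη : RotationInvariantDisorder P η M) (hε : 0 ≤ ε) :
    ∃ C : ℝ, ∀ {β : ENNReal}, β ≠ 0 → ∀ {e : Vec N}, ‖e‖ = 1 → ∀ {L : ℕ}, 1 ≤ L →
      ∀ (K : ℕ) (δ : ℝ) {a : Site d → ℝ}, (∀ x, |a x| ≤ ε) → ∀ᵐ ω ∂P,
        (P[fun ω => S.disorderedFreeEnergy β K a (δ • e) fun x => η x ω |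
            componentAlgebra η e L]) ω ≤
          (P[fun ω => S.disorderedFreeEnergy β K a (-(δ • e)) fun x => η x ω |
            componentAlgebra η e L]) ω + C * (L ^ d / L ^ 2 + L ^ d * |δ|) := by
  obtain ⟨C, hC, rotate_le⟩ := exists_disorderedFreeEnergy_rotate_farAngle_le hS hε
  refine ⟨C * (1 + (5 + 4 * S.clusterRadius) ^ d * M) / 2,
    fun {β} hβ {e} he {L} hL K δ {a} ha => ?_⟩
  obtain ⟨g, hg⟩ := exists_rotationGenerator hN he
  have flip_field : (g.J * g.J) *ᵥ (δ • e).ofLp = -(δ • e).ofLp := by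
    rw [WithLp.ofLp_smul, Matrix.mulVec_smul, hg, smul_neg]
  have condExp_forward := S.condExp_disorderedFreeEnergy_rotate_eq hη hβ K a (δ • e) e
    (R := fun x => g.rot (S.farAngle K L x))
    fun x hx => by rw [S.farAngle_eq_zero K hx, g.rot_zero]
  have condExp_backward := S.condExp_disorderedFreeEnergy_rotate_eq hη hβ K a (δ • e) e
    (R := fun x => g.rot (-S.farAngle K L x))
    fun x hx => by rw [S.farAngle_eq_zero K hx, neg_zero, g.rot_zero]
  set t : ℝ := L ^ d / L ^ 2 + L ^ d * |δ|
  have condExp_cost := hη.condExp_comp_sum_norm_eq_integral e (B := S.transitionRegion K L)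
    (Finset.disjoint_left.2 fun x hx => notMem_box_of_mem_annulus hx)
    (φ := fun s => C * (t + s / L ^ 2)) (by fun_prop)
  have cost_integrable : Integrable (fun ω =>
      C * (t + (∑ x ∈ S.transitionRegion K L, ‖η x ω‖) / L ^ 2)) P :=
    ((integrable_const t).add
      ((integrable_finsetSum _ fun x _ => hη.integrable_norm x).div_const _)).const_mul C
  have flipped := condExp_le_of_add_le
    (S.integrable_disorderedFreeEnergy_rotate hη hβ K a (δ • e) _)
    (S.integrable_disorderedFreeEnergy_rotate hη hβ K a (δ • e) _)
    (S.integrable_disorderedFreeEnergy hη hβ K a (-(δ • e)))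
    cost_integrable condExp_forward condExp_backward condExp_cost fun ω => by
      simpa only [norm_smul, he, mul_one, Real.norm_eq_abs] using
        rotate_le g flip_field hβ K hL ha fun x => η x ω
  filter_upwards [flipped] with ω hω
  linarith [integral_transitionRegion_cost_le (S := S) hη K hL hC
    (le_add_of_nonneg_right (by positivity) : (L : ℝ) ^ d / L ^ 2 ≤ t)]

lemma exists_abs_condExp_disorderedFreeEnergy_sub_le (hN : 2 ≤ N) (hS : S.ShortRange)
    (hη : RotationInvariantDisorder P η M) (hε : 0 ≤ ε) :
    ∃ C : ℝ, ∀ {β : ENNReal}, β ≠ 0 → ∀ {e : Vec N}, ‖e‖ = 1 → ∀ {L : ℕ}, 1 ≤ L →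
      ∀ (K : ℕ) (δ : ℝ) {a : Site d → ℝ}, (∀ x, |a x| ≤ ε) → ∀ᵐ ω ∂P,
        |(P[fun ω => S.disorderedFreeEnergy β K a (δ • e) fun x => η x ω |
            componentAlgebra η e L]) ω -
          (P[fun ω => S.disorderedFreeEnergy β K a (-(δ • e)) fun x => η x ω |
            componentAlgebra η e L]) ω| ≤ C * (L ^ d / L ^ 2 + L ^ d * |δ|) := by
  obtain ⟨C, condExp_le⟩ := exists_condExp_disorderedFreeEnergy_le hN hS hη hε
  refine ⟨C, fun hβ _ he _ hL K δ _ ha => ?_⟩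
  have reversed := condExp_le hβ he hL K (-δ) ha
  rw [neg_smul, neg_neg, abs_neg] at reversed
  filter_upwards [condExp_le hβ he hL K δ ha, reversed] with ω h₁ h₂
  exact abs_sub_le_iff.2 ⟨by linarith, by linarith⟩

lemma freeEnergyDifference_eq (hη : RotationInvariantDisorder P η M) {β : ENNReal} (hβ : β ≠ 0)
    (ε : ℝ) (e : Vec N) (L K : ℕ) (δ : ℝ) :
    S.freeEnergyDifference P η β ε e L K δ =ᵐ[P] fun ω => 1 / 2 *
      (((P[fun ω => S.disorderedFreeEnergy β K (fun _ => ε) (δ • e) fun x => η x ω |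
            componentAlgebra η e L]) ω -
        (P[fun ω => S.disorderedFreeEnergy β K (fun _ => ε) (-(δ • e)) fun x => η x ω |
            componentAlgebra η e L]) ω) -
      ((P[fun ω => S.disorderedFreeEnergy β K (fun x => if x ∈ box d L then 0 else ε) (δ • e)
            fun x => η x ω | componentAlgebra η e L]) ω -
        (P[fun ω => S.disorderedFreeEnergy β K (fun x => if x ∈ box d L then 0 else ε) (-(δ • e))
            fun x => η x ω | componentAlgebra η e L]) ω)) := by
  have integrable := S.integrable_disorderedFreeEnergy hη hβ K
  have sub_integrable := (integrable (fun _ => ε) (δ • e)).sub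
    (integrable (fun x => if x ∈ box d L then 0 else ε) (δ • e))
  have sub_sub_integrable := sub_integrable.sub (integrable (fun _ => ε) (-(δ • e)))
  filter_upwards [
    condExp_add sub_sub_integrable
      (integrable (fun x => if x ∈ box d L then 0 else ε) (-(δ • e))) (componentAlgebra η e L),
    condExp_sub sub_integrable (integrable (fun _ => ε) (-(δ • e))) (componentAlgebra η e L),
    condExp_sub (integrable (fun _ => ε) (δ • e))
      (integrable (fun x => if x ∈ box d L then 0 else ε) (δ • e)) (componentAlgebra η e L)]
    with ω add sub sub'
  simp only [Pi.add_apply, Pi.sub_apply] at add sub sub'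
  simp only [freeEnergyDifference, F_resetField_eq, Pi.smul_apply, smul_eq_mul]
  simp only [F_eq]
  congr 1
  refine add.trans ?_
  rw [sub, sub']
  ring

lemma exists_abs_freeEnergyDifference_sub_integral_le (hN : 2 ≤ N) (hS : S.ShortRange)
    (hη : RotationInvariantDisorder P η M) (ε : ℝ) :
    ∃ C : ℝ, ∀ {β : ENNReal}, β ≠ 0 → ∀ {e : Vec N}, ‖e‖ = 1 → ∀ {L : ℕ}, 1 ≤ L →
      ∀ (K : ℕ) (δ : ℝ), ∀ᵐ ω ∂P, |S.freeEnergyDifference P η β ε e L K δ ω -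
        ∫ ω', S.freeEnergyDifference P η β ε e L K δ ω' ∂P| ≤
          C * (L ^ d / L ^ 2 + L ^ d * |δ|) := by
  obtain ⟨C, close⟩ := exists_abs_condExp_disorderedFreeEnergy_sub_le hN hS hη
    (abs_nonneg ε)
  refine ⟨2 * C, fun hβ e he L hL K δ => ?_⟩
  have reset_le (x : Site d) : |if x ∈ box d L then 0 else ε| ≤ |ε| := by split_ifs <;> simp
  simp only [mul_assoc]
  refine abs_sub_integral_le ?_
  filter_upwards [freeEnergyDifference_eq (S := S) hη hβ ε e L K δ,
    close hβ he hL K δ fun _ => le_rfl, close hβ he hL K δ reset_le] with ω eq full_le reset_le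
  rw [eq, abs_mul, abs_of_pos one_half_pos]
  linarith [(abs_sub _ _).trans (add_le_add full_le reset_le)]

end SymmetricSystem

end FreeEnergyDifference

end QuantumImryMa

end

open QuantumImryMa in
theorem mainTheorem5_general {d N : ℕ} (hN : 2 ≤ N) {ι : Type*} [Fintype ι] [DecidableEq ι]
    [Nonempty ι] (S : SymmetricSystem d N ι) (hS : S.ShortRange) {Ω : Type*} [MeasurableSpace Ω]
    (P : Measure Ω) [IsProbabilityMeasure P] (η : Site d → Ω → Vec N) {M : ℝ}
    (hη : RotationInvariantDisorder P η M) (ε : ℝ) :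
    ∃ C : ℝ, ∀ (β : ENNReal), β ≠ 0 → ∀ e : Vec N, ‖e‖ = 1 →
      ∀ (δ : ℕ → ℝ) (K : ℕ → ℕ), Tendsto δ atTop (𝓝 0) →
      ∀ (L : ℕ), 1 ≤ L → ∀ G : Ω → ℝ, S.IsLimitFreeEnergyDifference P η β ε e δ K L G →
        ∀ᵐ ω ∂P, |G ω| ≤ C * (L : ℝ) ^ ((d : ℤ) - 2) := by
  obtain ⟨C, finite_volume⟩ := SymmetricSystem.exists_abs_freeEnergyDifference_sub_integral_le
    hN hS hη ε
  refine ⟨C, fun β hβ e he δ K hδ L hL G ⟨g, hg⟩ => ?_⟩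
  have finite_volume_ae := ae_all_iff.2 fun i => ae_all_iff.2 fun j =>
    finite_volume hβ he hL (K j) (δ i)
  filter_upwards [hg, finite_volume_ae] with ω ⟨tendsto_g, tendsto_G⟩ bound
  have g_le (i : ℕ) : |g i ω| ≤ C * (L ^ d / L ^ 2 + L ^ d * |δ i|) :=
    le_of_tendsto (tendsto_g i).abs (Eventually.of_forall (bound i))
  have bound_tendsto : Tendsto (fun i => C * ((L : ℝ) ^ d / L ^ 2 + L ^ d * |δ i|)) atTop
      (𝓝 (C * ((L : ℝ) ^ d / L ^ 2 + L ^ d * |0|))) :=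
    ((hδ.abs.const_mul _).const_add _).const_mul _
  have G_le := le_of_tendsto_of_tendsto' tendsto_G.abs bound_tendsto g_le
  rwa [abs_zero, mul_zero, add_zero, ← zpow_natCast, ← zpow_natCast (L : ℝ) 2,
    ← zpow_sub₀ (Nat.cast_ne_zero.2 (Nat.one_le_iff_ne_zero.1 hL))] at G_le

theorem mainTheorem5 {d N : ℕ} (hN : 2 ≤ N) {ι : Type*} [Fintype ι] [DecidableEq ι] [Nonempty ι]
    (S : QuantumImryMa.SymmetricSystem d N ι) (hS : S.FiniteRange ∨ S.ShortRange)
    {Ω : Type*} [MeasurableSpace Ω] (P : Measure Ω) [IsProbabilityMeasure P]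
    (η : QuantumImryMa.Site d → Ω → QuantumImryMa.Vec N)
    (hη : QuantumImryMa.IsotropicDisorder P η) (ε : ℝ) :
    ∃ C : ℝ, ∀ (β : ENNReal), β ≠ 0 → ∀ e : QuantumImryMa.Vec N, ‖e‖ = 1 →
      ∀ (δ : ℕ → ℝ) (K : ℕ → ℕ), Tendsto δ atTop (𝓝 0) → Tendsto K atTop atTop →
      ∀ (L : ℕ), 1 ≤ L → ∀ G : Ω → ℝ, S.IsLimitFreeEnergyDifference P η β ε e δ K L G →
        ∀ᵐ ω ∂P, |G ω| ≤ C * (L : ℝ) ^ ((d : ℤ) - 2) := by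
  obtain ⟨C, hC⟩ := mainTheorem5_general hN S (hS.elim (fun h => h.shortRange) id) P η
    hη.rotationInvariantDisorder ε
  exact ⟨C, fun β hβ e he δ K hδ _ => hC β hβ e he δ K hδ⟩
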